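/- Let $h : M \to S$ be a continuous mapping from a metric space $M$ to a locally compact separable metric space $S$, both with their Borel $\sigma$-algebras. A (time-homogeneous) Markov family on $M$ consists of processes $X^x_t$, $t \ge 0$, $x \in M$, with values in $M$ such that $X^x_0 = x$ almost surely, $p(t,x,B) = \mathrm{P}(X^x_t \in B)$ is measurable in $x$ for all $t \ge 0$ and Borel $B$, and $\mathrm{P}(X^x_{s+t} \in B \mid \sigma(X^x_u, u \le s)) = p(t, X^x_s, B)$ almost surely for all $s,t \ge 0$, $x \in M$ and Borel $B$. For each $\varepsilon > 0$, let $X^{x,\varepsilon}_t$, $x \in M$, be a Markov family on $M$, and suppose that the processes $Y^{x,\varepsilon}_t = h(X^{x,\varepsilon}_t)$, $x \in M$, $\varepsilon > 0$, have continuous trajectories. Let $Y^y_t$, $y \in S$, be a Markov family on $S$ with continuous trajectories whose semigroup $(T_t f)(y) = \mathrm{E} f(Y^y_t)$, $t \ge 0$, preserves the space $C_0(S)$ of real continuous functions vanishing at infinity, with the supremum norm. Let $A : \mathcal{D}(A) \to C_0(S)$ be the infinitesimal generator of this family, i.e. $Af = \lim_{t \downarrow 0} (T_t f - f)/t$ in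 $C_0(S)$, with $\mathcal{D}(A)$ the set of all $f \in C_0(S)$ for which this limit exists. Let $\Psi$ be a dense linear subspace of $C_0(S)$ and $\mathcal{D}$ a linear subspace of $\mathcal{D}(A)$ such that: (1) There is $\lambda > 0$ such that for each $f \in \Psi$ the equation $\lambda F - AF = f$ has a solution $F \in \mathcal{D}$. (2) For each $T > 0$, each $f \in \mathcal{D}$, and each compact $K \subseteq S$, $$\lim_{\varepsilon \downarrow 0} \mathrm{E}\left( f(Y^{x,\varepsilon}_T) - f(Y^{x,\varepsilon}_0) - \int_0^T Af(Y^{x,\varepsilon}_t)\,dt \right) = 0, \quad \text{uniformly in } x \in h^{-1}(K).$$ Suppose also that, for each $x \in M$, the family of measures on $C([0,\infty), S)$ (with the topology of uniform convergence on compact sets) induced by the processes $Y^{x,\varepsilon}_t$, $\varepsilon > 0$, is tight. Then, for each $x \in M$, the measures on $C([0,\infty), S)$ induced by the processes $Y^{x,\varepsilon}_t$ converge weakly, as $\varepsilon \downarrow 0$, to the measure induced by the process $Y^{h(x)}_t$. -/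

import Mathlib

open MeasureTheory ProbabilityTheory Filter Topology
open scoped NNReal ENNReal ZeroAtInfty

noncomputable section

/-- The σ-algebra generated by `X u`, `u ≤ s`. -/
abbrev processPast {Ω M : Type*} [MeasurableSpace M] (X : ℝ≥0 → Ω → M) (s : ℝ≥0) :
    MeasurableSpace Ω :=
  ⨆ u : Set.Iic s, MeasurableSpace.comap (X u) inferInstance

/-- A (time-homogeneous, conservative) Markov family on `M`: for every starting point `x`, a process
`X x t`, `t ≥ 0`, on a probability space `(Ω x, P x)`. The Markov property is with respect to the
filtration generated by the process. -/
structure MarkovFamily (M : Type*) [MeasurableSpace M] where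
  Ω : M → Type*
  mΩ : ∀ x, MeasurableSpace (Ω x)
  P : ∀ x, Measure (Ω x)
  isProb : ∀ x, IsProbabilityMeasure (P x)
  X : ∀ x, ℝ≥0 → Ω x → M
  measurable_X : ∀ x t, Measurable (X x t)
  /-- the transition probabilities depend measurably on the starting point -/
  measurable_trans : ∀ (t : ℝ≥0) (B : Set M), MeasurableSet B →
    Measurable fun x => P x (X x t ⁻¹' B)
  start : ∀ x, ∀ᵐ ω ∂P x, X x 0 ω = x
  markov : ∀ (x : M) (s t : ℝ≥0) (B : Set M), MeasurableSet B →
    (P x)[(X x (s + t) ⁻¹' B).indicator (fun _ => (1 : ℝ)) | processPast (X x) s]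
      =ᵐ[P x] fun ω => (P (X x s ω)).real (X (X x s ω) t ⁻¹' B)

attribute [instance] MarkovFamily.mΩ MarkovFamily.isProb

/-- The path space `C([0, ∞), S)`, with the topology of uniform convergence on compact
sets (the compact-open topology), carries its Borel σ-algebra. -/
instance pathMeasurableSpace {S : Type*} [TopologicalSpace S] : MeasurableSpace C(ℝ≥0, S) :=
  borel _

instance pathBorelSpace {S : Type*} [TopologicalSpace S] : BorelSpace C(ℝ≥0, S) := ⟨rfl⟩

section PathLaw

variable {S : Type*} [MetricSpace S] [TopologicalSpace.SeparableSpace S]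
  [MeasurableSpace S] [BorelSpace S] {Ω : Type*} [MeasurableSpace Ω]

theorem measurable_path (Z : ℝ≥0 → Ω → S) (hm : ∀ t, Measurable (Z t))
    (hc : ∀ ω, Continuous fun t => Z t ω) :
    Measurable (fun ω => (⟨fun t => Z t ω, hc ω⟩ : C(ℝ≥0, S))) := by
  have : SecondCountableTopology S := UniformSpace.secondCountable_of_separable S
  have hb : (pathMeasurableSpace : MeasurableSpace C(ℝ≥0, S)) = _ :=
    borel_eq_generateFrom_of_subbasis (ContinuousMap.compactOpen_eq (X := ℝ≥0) (Y := S))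
  rw [hb]
  refine measurable_generateFrom ?_
  rintro _ ⟨K, hK, U, hU, rfl⟩
  obtain ⟨c, hcK, hcc, hKc⟩ :=
    (TopologicalSpace.IsSeparable.of_separableSpace K).exists_countable_dense_subset
  have key : ((fun ω => (⟨fun t => Z t ω, hc ω⟩ : C(ℝ≥0, S))) ⁻¹' {f | Set.MapsTo f K U}) =
      ⋃ n : ℕ, ⋂ t ∈ c, {ω | ((n : ℝ≥0∞))⁻¹ ≤ Metric.infEDist (Z t ω) Uᶜ} := by
    ext ω
    have hcont : Continuous fun t => Metric.infEDist (Z t ω) Uᶜ :=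
      Metric.continuous_infEDist.comp (hc ω)
    have hpos : ∀ t, 0 < Metric.infEDist (Z t ω) Uᶜ ↔ Z t ω ∈ U := fun t => by
      rw [Metric.infEDist_pos_iff_notMem_closure, hU.isClosed_compl.closure_eq, Set.notMem_compl_iff]
    simp only [Set.mem_preimage, Set.mem_ofPred_eq, Set.mem_iUnion, Set.mem_iInter]
    constructor
    · intro hmaps
      rcases K.eq_empty_or_nonempty with hKe | hKne
      · exact ⟨0, fun t ht => by simpa [hKe] using hcK ht⟩
      · obtain ⟨t₀, ht₀, hmin⟩ := hK.exists_isMinOn hKne hcont.continuousOn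
        obtain ⟨n, hn⟩ := ENNReal.exists_inv_nat_lt ((hpos t₀).2 (hmaps ht₀)).ne'
        exact ⟨n, fun t ht => hn.le.trans (hmin (hcK ht))⟩
    · rintro ⟨n, hn⟩ t ht
      have hcl : closure c ⊆ {t | ((n : ℝ≥0∞))⁻¹ ≤ Metric.infEDist (Z t ω) Uᶜ} :=
        closure_minimal hn (isClosed_le continuous_const hcont)
      exact (hpos t).1 (lt_of_lt_of_le (by simp) (hcl (hKc ht)))
  rw [key]
  exact MeasurableSet.iUnion fun n => MeasurableSet.biInter hcc fun t _ =>
    measurableSet_le measurable_const (Metric.continuous_infEDist.measurable.comp (hm t))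

/-- The measure induced on `C([0, ∞), S)` by a process with continuous trajectories. -/
def pathLaw (P : Measure Ω) [IsProbabilityMeasure P] (Z : ℝ≥0 → Ω → S)
    (hm : ∀ t, Measurable (Z t)) (hc : ∀ ω, Continuous fun t => Z t ω) :
    ProbabilityMeasure C(ℝ≥0, S) :=
  ⟨P.map fun ω => (⟨fun t => Z t ω, hc ω⟩ : C(ℝ≥0, S)),
    Measure.isProbabilityMeasure_map (measurable_path Z hm hc).aemeasurable⟩

end PathLaw

/-- The infinitesimal generator of a one-parameter family `T` of linear operators on a Banach
space: `A f` is the norm limit of `(T t f - f) / t` as `t ↓ 0`, and the domain is the set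
of those `f` for which the limit exists. -/
def infinitesimalGenerator {E : Type*} [NormedAddCommGroup E] [NormedSpace ℝ E]
    (T : ℝ≥0 → E →ₗ[ℝ] E) : E →ₗ.[ℝ] E where
  domain :=
    { carrier := {f | ∃ g, Tendsto (fun t : ℝ≥0 => (t : ℝ)⁻¹ • (T t f - f)) (𝓝[>] 0) (𝓝 g)}
      zero_mem' := ⟨0, by simp⟩
      add_mem' := by
        rintro f₁ f₂ ⟨g₁, h₁⟩ ⟨g₂, h₂⟩
        refine ⟨g₁ + g₂, (h₁.add h₂).congr fun t => ?_⟩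
        rw [map_add, ← smul_add]
        congr 1
        abel
      smul_mem' := by
        rintro c f ⟨g, h⟩
        refine ⟨c • g, (h.const_smul c).congr fun t => ?_⟩
        rw [map_smul, ← smul_sub, smul_comm] }
  toFun :=
    { toFun := fun f => f.2.choose
      map_add' := by
        rintro f₁ f₂
        refine tendsto_nhds_unique (f₁ + f₂).2.choose_spec
          ((f₁.2.choose_spec.add f₂.2.choose_spec).congr fun t => ?_)
        rw [Submodule.coe_add, map_add, ← smul_add]
        congr 1
        abel
      map_smul' := by
        rintro c f
        refine tendsto_nhds_unique (c • f).2.choose_spec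
          ((f.2.choose_spec.const_smul c).congr fun t => ?_)
        rw [Submodule.coe_smul, map_smul, ← smul_sub, smul_comm] }

namespace MarkovFamily

variable {S : Type*} [MetricSpace S] [MeasurableSpace S] [BorelSpace S]

/-- The transition semigroup maps `C₀(S)` into itself: `y ↦ E f(Y^y_t)` is in `C₀(S)`
whenever `f` is. -/
def PreservesC0 (Y : MarkovFamily S) : Prop :=
  ∀ (t : ℝ≥0) (f : C₀(S, ℝ)), ∃ g : C₀(S, ℝ), ∀ y, g y = ∫ ω, f (Y.X y t ω) ∂(Y.P y)

theorem integrable_comp (Y : MarkovFamily S) (f : C₀(S, ℝ)) (t : ℝ≥0) (y : S) :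
    Integrable (fun ω => f (Y.X y t ω)) (Y.P y) :=
  Integrable.of_bound
    ((f.continuous.measurable.comp (Y.measurable_X y t)).aestronglyMeasurable) ‖f‖
    (Eventually.of_forall fun ω => by
      have := f.toBCF.norm_coe_le_norm (Y.X y t ω)
      simpa using this)

/-- The transition semigroup `(T t f) y = E f(Y^y_t)` on `C₀(S)`. -/
def semigroup (Y : MarkovFamily S) (hY : Y.PreservesC0) (t : ℝ≥0) : C₀(S, ℝ) →ₗ[ℝ] C₀(S, ℝ) where
  toFun f := (hY t f).choose
  map_add' f g := by
    ext y
    rw [ZeroAtInftyContinuousMap.add_apply, (hY t f).choose_spec, (hY t g).choose_spec,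
      (hY t (f + g)).choose_spec,
      ← integral_add (Y.integrable_comp f t y) (Y.integrable_comp g t y)]
    rfl
  map_smul' c f := by
    ext y
    rw [RingHom.id_apply, ZeroAtInftyContinuousMap.smul_apply, (hY t f).choose_spec,
      (hY t (c • f)).choose_spec, ← integral_smul]
    rfl

theorem semigroup_apply (Y : MarkovFamily S) (hY : Y.PreservesC0) (t : ℝ≥0) (f : C₀(S, ℝ))
    (y : S) : Y.semigroup hY t f y = ∫ ω, f (Y.X y t ω) ∂(Y.P y) :=
  (hY t f).choose_spec y

/-- The infinitesimal generator of the Markov family, as an unbounded operator on `C₀(S)`. -/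
def generator (Y : MarkovFamily S) (hY : Y.PreservesC0) : C₀(S, ℝ) →ₗ.[ℝ] C₀(S, ℝ) :=
  infinitesimalGenerator (Y.semigroup hY)

end MarkovFamily

end

/-! ### Uniqueness for the Laplace transform of a bounded continuous function -/

/-! By tightness and Prokhorov's theorem it is enough to identify every limit point `μ` of the laws
of `h (X ε)` started from `x`. This is done through the martingale problem for `(F, AF)`, `F ∈ D`.

Existence: the Markov property of `X ε` at time `s` turns a Dynkin increment weighted by a function
of the past into the Dynkin defect of the process restarted from its position at `s`
(`integral_mul_dynkin`). Tightness keeps `h` of that position in a compact set up to small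
probability, and there the defect is uniformly small. Hence `μ` solves the martingale problem
(`solvesMartingaleProblem_of_tendsto`). The law of the Feller process solves it too, by Dynkin's
formula.

Uniqueness: for two solutions agreeing up to time `s`, the difference `N t` of the functionals `f ↦
E[Φ f(w (s + t))]` satisfies `N t F = ∫₀ᵗ N r (AF) dr`. Its Laplace transform at `a > 0` therefore
annihilates `(a - A) D`. The generator is dissipative and `(l - A) D` contains the dense space `Ψ`,
so `(a - A) D` is dense for every `a > 0` (`dense_range_smul_sub`), the transform vanishes, and `N =
0` (`eq_zero_of_forward_equation`). Induction over the time points gives equality of all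
finite-dimensional distributions, which determine a law on path space. -/

theorem integrableOn_exp_neg_mul_mul_of_bounded {u : ℝ → ℝ} (hu : Continuous u) {C : ℝ}
    (hC : ∀ t, |u t| ≤ C) {a : ℝ} (ha : 0 < a) :
    IntegrableOn (fun t => Real.exp (-a * t) * u t) (Set.Ioi 0) := by
  refine Integrable.mul_bdd (c := C) (exp_neg_integrableOn_Ioi 0 ha)
    hu.aestronglyMeasurable (Eventually.of_forall fun t => ?_)
  simpa using hC t

/-- The monomial of degree `i` in `exp (-t)`, times the extra factor `exp (-t)`, gives the Laplace
transform at `i + 1`; the extra factor keeps degree zero integrable. -/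
theorem integral_polynomial_exp_neg_mul_eq_zero {u : ℝ → ℝ} (hu : Continuous u) {C : ℝ}
    (hC : ∀ t, |u t| ≤ C)
    (h0 : ∀ a : ℝ, 0 < a → ∫ t in Set.Ioi (0 : ℝ), Real.exp (-a * t) * u t = 0)
    (p : Polynomial ℝ) :
    ∫ t in Set.Ioi (0 : ℝ), p.eval (Real.exp (-t)) * (Real.exp (-t) * u t) = 0 := by
  have hterm : ∀ (i : ℕ) (t : ℝ), p.coeff i * Real.exp (-t) ^ i * (Real.exp (-t) * u t)
      = p.coeff i * (Real.exp (-((i : ℝ) + 1) * t) * u t) := by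
    intro i t
    rw [← Real.exp_nat_mul, mul_assoc, ← mul_assoc (Real.exp _) (Real.exp _), ← Real.exp_add]
    ring_nf
  simp_rw [Polynomial.eval_eq_sum_range, Finset.sum_mul, hterm]
  rw [integral_finsetSum]
  · refine Finset.sum_eq_zero fun i _ => ?_
    rw [integral_const_mul, h0 _ (by positivity), mul_zero]
  · exact fun i _ => (integrableOn_exp_neg_mul_mul_of_bounded hu hC (by positivity)).const_mul _

/-- A bounded continuous function whose Laplace transform vanishes is zero on `[0, ∞)`. -/
theorem eq_zero_of_laplace_eq_zero {u : ℝ → ℝ} (hu : Continuous u) {C : ℝ}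
    (hC : ∀ t, |u t| ≤ C)
    (h0 : ∀ a : ℝ, 0 < a → ∫ t in Set.Ioi (0 : ℝ), Real.exp (-a * t) * u t = 0)
    {t : ℝ} (ht : 0 ≤ t) : u t = 0 := by
  have hC0 : 0 ≤ C := (abs_nonneg _).trans (hC 0)
  -- Substituting `x = exp (-t)` moves `exp (-t) * u t` to `[0, 1]`, where Weierstrass approximation
  -- applies. The factor `x` forces continuity at `0`, as `u` is only bounded.
  let k : ℝ → ℝ := fun x => x * u (-Real.log x)
  have hk : Continuous k := by
    rw [continuous_iff_continuousAt]
    intro x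
    by_cases hx : x = 0
    · subst hx
      have : Tendsto k (𝓝 0) (𝓝 0) := by
        refine squeeze_zero_norm (a := fun x => |x| * C) (fun x => ?_) ?_
        · simp only [k, norm_mul, Real.norm_eq_abs]
          gcongr
          exact hC _
        · have : Continuous fun x : ℝ => |x| * C := by fun_prop
          simpa using this.tendsto 0
      simpa [ContinuousAt, k] using this
    · exact continuousAt_id.mul (hu.continuousAt.comp (Real.continuousAt_log hx).neg)
  have hkexp : ∀ t, k (Real.exp (-t)) = Real.exp (-t) * u t := fun t => by simp [k]
  let v : ℝ → ℝ := fun t => (Real.exp (-t) * u t) * (Real.exp (-t) * u t)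
  have hi1 : IntegrableOn (fun t => Real.exp (-t) * u t) (Set.Ioi 0) := by
    simpa using integrableOn_exp_neg_mul_mul_of_bounded hu hC one_pos
  have hie : IntegrableOn (fun t => Real.exp (-t)) (Set.Ioi 0) := by
    simpa using exp_neg_integrableOn_Ioi 0 one_pos
  have hcomp : ∀ g : ℝ → ℝ, Continuous g →
      IntegrableOn (fun t => g (Real.exp (-t)) * (Real.exp (-t) * u t)) (Set.Ioi 0) := by
    intro g hg
    obtain ⟨B, hB⟩ := (isCompact_Icc (a := (0 : ℝ)) (b := 1)).exists_bound_of_continuousOn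
      hg.continuousOn
    refine Integrable.bdd_mul (c := B) hi1 (by fun_prop) ?_
    refine (ae_restrict_iff' measurableSet_Ioi).2 (Eventually.of_forall fun t ht => ?_)
    exact hB _ ⟨(Real.exp_pos _).le, Real.exp_le_one_iff.2 (by simpa using ht.le)⟩
  have hiv : IntegrableOn v (Set.Ioi 0) := by
    simpa only [hkexp] using hcomp k hk
  have hI1 : ∫ t in Set.Ioi (0 : ℝ), Real.exp (-t) = 1 := by
    simpa using integral_exp_neg_Ioi 0
  have hint : ∫ t in Set.Ioi (0 : ℝ), v t = 0 := by
    -- In the square `v`, one factor is replaced by a polynomial in `exp (-t)`, whose contribution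
    -- integrates to zero. The tolerance `δ / (C + 1)` absorbs the bound on `u` and allows `C = 0`.
    refine abs_nonpos_iff.1 (le_of_forall_pos_le_add fun δ hδ => ?_)
    obtain ⟨p, hp⟩ := exists_polynomial_near_of_continuousOn 0 1 k hk.continuousOn
      (δ / (C + 1)) (by positivity)
    have hz := integral_polynomial_exp_neg_mul_eq_zero hu hC h0 p
    have : ∫ t in Set.Ioi (0 : ℝ), v t = ∫ t in Set.Ioi (0 : ℝ),
        (v t - p.eval (Real.exp (-t)) * (Real.exp (-t) * u t)) := by
      rw [integral_sub hiv (hcomp _ p.continuous), hz, sub_zero]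
    rw [this, ← Real.norm_eq_abs]
    have hb : ‖∫ t in Set.Ioi (0 : ℝ),
        (v t - p.eval (Real.exp (-t)) * (Real.exp (-t) * u t))‖
        ≤ ∫ t in Set.Ioi (0 : ℝ), δ * Real.exp (-t) := by
      refine norm_integral_le_of_norm_le (hie.const_mul δ)
        ((ae_restrict_iff' measurableSet_Ioi).2 (Eventually.of_forall fun t ht => ?_))
      have h1 := hp _ ⟨(Real.exp_pos (-t)).le, Real.exp_le_one_iff.2 (by simpa using ht.le)⟩
      have e1 : v t - p.eval (Real.exp (-t)) * (Real.exp (-t) * u t) =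
          -(p.eval (Real.exp (-t)) - k (Real.exp (-t))) * u t * Real.exp (-t) := by
        rw [hkexp]; simp only [v]; ring
      rw [e1, norm_mul, norm_mul, norm_neg, Real.norm_eq_abs, Real.norm_eq_abs, Real.norm_eq_abs,
        abs_of_pos (Real.exp_pos _)]
      gcongr
      calc _ ≤ δ / (C + 1) * C := by gcongr; exact hC t
        _ ≤ δ / (C + 1) * (C + 1) := by gcongr; linarith
        _ = δ := by field_simp
    refine hb.trans ?_
    rw [integral_const_mul, hI1]
    simp
  have hae : v =ᵐ[volume.restrict (Set.Ioi 0)] 0 :=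
    (setIntegral_eq_zero_iff_of_nonneg_ae
      (Eventually.of_forall fun t => mul_self_nonneg _) hiv).1 hint
  have hvc : Continuous v := by fun_prop
  have heq : Set.EqOn v 0 (Set.Ioi 0) :=
    Measure.eqOn_open_of_ae_eq hae isOpen_Ioi hvc.continuousOn continuousOn_const
  have heq' : Set.EqOn v 0 (closure (Set.Ioi 0)) := heq.closure hvc continuous_const
  rw [closure_Ioi] at heq'
  simpa [v] using heq' ht

/-! ### Ranges of dissipative operators -/

section Dissipative

variable {E : Type*} [NormedAddCommGroup E] [NormedSpace ℝ E]

/-- If `A` is dissipative and `l - A` has dense range, then `m - A` has dense range for all `m` in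
`(0, 2l)`. -/
theorem dense_range_smul_sub_of_lt {D : Type*} [AddCommMonoid D] [Module ℝ D]
    (i A : D →ₗ[ℝ] E)
    (hdiss : ∀ m : ℝ, 0 < m → ∀ F, m * ‖i F‖ ≤ ‖m • i F - A F‖)
    {l : ℝ} (hl : 0 < l) (hd : DenseRange fun F => l • i F - A F)
    {m : ℝ} (hm : 0 < m) (hml : m < 2 * l) : DenseRange fun F => m • i F - A F := by
  let W : Submodule ℝ E := LinearMap.range (m • i - A)
  have hW : Set.range (fun F => m • i F - A F) = (W : Set E) := by ext; simp [W]
  by_contra hnd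
  rw [DenseRange, hW] at hnd
  have hex : ∃ x, x ∉ W.topologicalClosure := by
    by_contra! hall
    exact hnd fun x => hall x
  -- Dissipativity bounds `|m - l| * ‖i F‖` by `q * ‖l • i F - A F‖`, and `q < 1` is exactly `0 < m
  -- < 2 * l`.
  set q : ℝ := |m - l| / l with hq
  have hq1 : q < 1 := by
    rw [hq, div_lt_one hl, abs_lt]
    constructor <;> linarith
  have hq0 : 0 ≤ q := by positivity
  -- Riesz's lemma gives `g` at distance at least `(q + 1) / 2 * ‖g‖` from the range. But if `l • i
  -- F - A F` is within `δ` of `g`, then `m • i F - A F` is within `δ + q * (‖g‖ + δ)`, which the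
  -- choice of `δ` makes smaller.
  obtain ⟨g, hg, hgW⟩ := riesz_lemma (𝕜 := ℝ) (F := W.topologicalClosure)
    W.isClosed_topologicalClosure hex (r := (q + 1) / 2) (by linarith)
  have hg0 : 0 < ‖g‖ := norm_pos_iff.2 fun h => hg (h ▸ Submodule.zero_mem _)
  obtain ⟨δ, hδ, hδlt⟩ : ∃ δ > 0, δ * (1 + q) < (1 - q) / 2 * ‖g‖ := by
    refine ⟨(1 - q) / 4 * ‖g‖ / (1 + q), by have := sub_pos.2 hq1; positivity, ?_⟩
    rw [div_mul_cancel₀ _ (by positivity)]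
    have := mul_pos (sub_pos.2 hq1) hg0
    linarith
  obtain ⟨F, hF⟩ := Metric.denseRange_iff.1 hd g δ hδ
  rw [dist_eq_norm] at hF
  have h1 := hgW (m • i F - A F) (W.le_topologicalClosure ⟨F, by simp⟩)
  have h2 : ‖g - (m • i F - A F)‖ ≤ ‖g - (l • i F - A F)‖ + |m - l| * ‖i F‖ := by
    have : g - (m • i F - A F) = (g - (l • i F - A F)) - (m - l) • i F := by
      rw [sub_smul]; abel
    rw [this]
    refine (norm_sub_le _ _).trans ?_
    rw [norm_smul, Real.norm_eq_abs]
  have h3 : ‖l • i F - A F‖ ≤ ‖g‖ + δ := by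
    have := norm_sub_le g (g - (l • i F - A F))
    rw [sub_sub_cancel] at this
    linarith
  have h4 : |m - l| * ‖i F‖ ≤ q * (‖g‖ + δ) := by
    have := (hdiss l hl F).trans h3
    calc |m - l| * ‖i F‖ = q * (l * ‖i F‖) := by rw [hq]; field_simp
      _ ≤ _ := by gcongr
  nlinarith

/-- One application reaches every `m` below twice the current parameter, so iteration reaches all
positive `m`. -/
theorem dense_range_smul_sub {D : Type*} [AddCommMonoid D] [Module ℝ D]
    (i A : D →ₗ[ℝ] E)
    (hdiss : ∀ m : ℝ, 0 < m → ∀ F, m * ‖i F‖ ≤ ‖m • i F - A F‖)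
    {l : ℝ} (hl : 0 < l) (hd : DenseRange fun F => l • i F - A F)
    {m : ℝ} (hm : 0 < m) : DenseRange fun F => m • i F - A F := by
  have key : ∀ n : ℕ, ∀ m : ℝ, 0 < m → m < (3 / 2) ^ n * (2 * l) →
      DenseRange fun F => m • i F - A F := by
    intro n
    induction n with
    | zero => exact fun m hm hml => dense_range_smul_sub_of_lt i A hdiss hl hd hm (by simpa using hml)
    | succ n ih =>
      intro m hm hml
      have hpos : (0 : ℝ) < (3 / 2) ^ n * (2 * l) := by positivity
      -- Restarting at `3 / 4` of the current bound, safely inside the known range, doubles to `3 /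
      -- 2` of that bound.
      refine dense_range_smul_sub_of_lt i A hdiss (l := 3 / 4 * ((3 / 2) ^ n * (2 * l)))
        (by positivity) (ih _ (by positivity) (by linarith)) hm ?_
      rw [pow_succ] at hml
      linarith
  obtain ⟨n, hn⟩ := pow_unbounded_of_one_lt (m / (2 * l)) (by norm_num : (1 : ℝ) < 3 / 2)
  exact key n m hm ((div_lt_iff₀ (by positivity)).1 hn)

/-- A uniformly bounded, weakly continuous curve of functionals vanishing at time zero and solving
`N' F = N (A F)` vanishes, provided `A` is dissipative and `l - A` has dense range. -/
theorem eq_zero_of_forward_equation {D : Type*} [AddCommMonoid D] [Module ℝ D]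
    (i A : D →ₗ[ℝ] E)
    (hdiss : ∀ m : ℝ, 0 < m → ∀ F, m * ‖i F‖ ≤ ‖m • i F - A F‖)
    {l : ℝ} (hl : 0 < l) (hd : DenseRange fun F => l • i F - A F)
    (N : ℝ → E →ₗ[ℝ] ℝ) {C : ℝ} (hC : ∀ t f, |N t f| ≤ C * ‖f‖)
    (hN : ∀ f, Continuous fun t => N t f)
    (h0 : ∀ f, N 0 f = 0)
    (hA : ∀ F, ∀ T : ℝ, 0 ≤ T → N T (i F) = ∫ t in (0 : ℝ)..T, N t (A F))
    {t : ℝ} (ht : 0 ≤ t) (f : E) : N t f = 0 := by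
  refine eq_zero_of_laplace_eq_zero (hN f) (fun t => hC t f) (fun a ha => ?_) ht
  have hint : ∀ f, IntegrableOn (fun t => Real.exp (-a * t) * N t f) (Set.Ioi 0) :=
    fun f => integrableOn_exp_neg_mul_mul_of_bounded (hN f) (fun t => hC t f) ha
  -- The Laplace transform of the curve at `a`, as a continuous functional; it vanishes once it
  -- vanishes on the dense range of `a - A`.
  let J : E →ₗ[ℝ] ℝ :=
    { toFun := fun f => ∫ t in Set.Ioi (0 : ℝ), Real.exp (-a * t) * N t f
      map_add' := fun f g => by
        simp_rw [map_add, mul_add]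
        exact integral_add (hint f) (hint g)
      map_smul' := fun c f => by
        simp_rw [map_smul, smul_eq_mul, mul_left_comm _ c]
        exact integral_const_mul _ _ }
  have hJ : Continuous J := by
    refine AddMonoidHomClass.continuous_of_bound J ((∫ t in Set.Ioi (0 : ℝ), Real.exp (-a * t)) * C)
      fun f => ?_
    have : ‖J f‖ ≤ ∫ t in Set.Ioi (0 : ℝ), Real.exp (-a * t) * (C * ‖f‖) := by
      refine norm_integral_le_of_norm_le ((exp_neg_integrableOn_Ioi 0 ha).mul_const _)
        (Eventually.of_forall fun t => ?_)
      rw [norm_mul, Real.norm_eq_abs, Real.norm_eq_abs, abs_of_pos (Real.exp_pos _)]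
      gcongr
      exact hC t f
    rwa [integral_mul_const, ← mul_assoc] at this
  have hdense := dense_range_smul_sub i A hdiss hl hd ha
  suffices h : (J : E → ℝ) = fun _ => 0 from congrFun h f
  refine hdense.equalizer hJ continuous_const (funext fun F => ?_)
  change ∫ t in Set.Ioi (0 : ℝ), Real.exp (-a * t) * N t (a • i F - A F) = 0
  -- Integration by parts: on the range of `a - A` the integrand has an explicit primitive, zero at
  -- time `0` by `h0` and at infinity by boundedness.
  have hderiv : ∀ x ∈ Set.Ioi (0 : ℝ), HasDerivAt (fun t => -(Real.exp (-a * t) * N t (i F)))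
      (Real.exp (-a * x) * N x (a • i F - A F)) x := by
    intro x hx
    have hNd : HasDerivAt (fun t => N t (i F)) (N x (A F)) x := by
      have := ((hN (A F)).integral_hasStrictDerivAt 0 x).hasDerivAt
      refine this.congr_of_eventuallyEq ?_
      filter_upwards [Ioi_mem_nhds hx] with t ht using hA F t (le_of_lt ht)
    have he : HasDerivAt (fun t => Real.exp (-a * t)) (Real.exp (-a * x) * (-a)) x := by
      simpa using ((hasDerivAt_id x).const_mul (-a)).exp
    refine (he.mul hNd).neg.congr_deriv ?_
    rw [map_sub, map_smul, smul_eq_mul]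
    ring
  have hlim : Tendsto (fun t => -(Real.exp (-a * t) * N t (i F))) atTop (𝓝 0) := by
    have he : Tendsto (fun t : ℝ => Real.exp (-a * t)) atTop (𝓝 0) :=
      Real.tendsto_exp_atBot.comp (tendsto_id.const_mul_atTop_of_neg (by linarith))
    refine squeeze_zero_norm (a := fun t => Real.exp (-a * t) * (C * ‖i F‖)) (fun t => ?_)
      (by simpa using he.mul_const (C * ‖i F‖))
    rw [norm_neg, norm_mul, Real.norm_eq_abs, Real.norm_eq_abs, abs_of_pos (Real.exp_pos _)]
    gcongr
    exact hC _ _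
  have hcont : Continuous fun t => -(Real.exp (-a * t) * N t (i F)) := by
    have := hN (i F)
    fun_prop
  rw [integral_Ioi_of_hasDerivAt_of_tendsto hcont.continuousWithinAt hderiv (hint _) hlim]
  simp [h0]

end Dissipative

/-! ### Auxiliary facts on integrals -/

/-- Fubini's theorem for a bounded random function with continuous trajectories. -/
theorem integral_intervalIntegral_of_continuous {Ω : Type*} [MeasurableSpace Ω] (P : Measure Ω)
    [IsFiniteMeasure P] {u : ℝ → Ω → ℝ} (hc : ∀ ω, Continuous fun t => u t ω)
    (hm : ∀ t, Measurable (u t)) {C : ℝ} (hC : ∀ t ω, |u t ω| ≤ C) (a b : ℝ) :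
    ∫ ω, (∫ t in a..b, u t ω) ∂P = ∫ t in a..b, (∫ ω, u t ω ∂P) := by
  refine (intervalIntegral_integral_swap ?_).symm
  have : IsFiniteMeasure (volume.restrict (Set.uIoc a b)) := ⟨by simp [Set.uIoc]⟩
  exact Integrable.of_bound
    (measurable_uncurry_of_continuous_of_measurable hc hm).aestronglyMeasurable C
    (Eventually.of_forall fun p => hC p.1 p.2)

theorem measurable_intervalIntegral_of_continuous {Ω : Type*} [MeasurableSpace Ω]
    {u : ℝ → Ω → ℝ} (hc : ∀ ω, Continuous fun t => u t ω)
    (hm : ∀ t, Measurable (u t)) (a b : ℝ) : Measurable fun ω => ∫ t in a..b, u t ω := by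
  have h : StronglyMeasurable fun p : Ω × ℝ => u p.2 p.1 :=
    ((measurable_uncurry_of_continuous_of_measurable hc hm).comp
      measurable_swap).stronglyMeasurable
  simp only [intervalIntegral]
  exact (h.integral_prod_right'.measurable).sub h.integral_prod_right'.measurable

theorem abs_intervalIntegral_le_of_bounded {u : ℝ → ℝ} {C : ℝ} (hC : ∀ t, |u t| ≤ C) (T : ℝ≥0) :
    |∫ t in (0 : ℝ)..T, u t| ≤ C * T := by
  have := intervalIntegral.norm_integral_le_of_norm_le_const (a := (0 : ℝ)) (b := T) (f := u)
    (C := C) fun t _ => hC t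
  simpa using this

theorem abs_integral_le_of_bounded {Ω : Type*} [MeasurableSpace Ω] (P : Measure Ω)
    [IsProbabilityMeasure P] {u : Ω → ℝ} {C : ℝ} (hC : ∀ ω, |u ω| ≤ C) :
    |∫ ω, u ω ∂P| ≤ C := by
  have := norm_integral_le_of_norm_le_const (μ := P) (f := u) (Eventually.of_forall hC)
  simpa using this

theorem continuous_integral_of_bounded {Ω : Type*} [MeasurableSpace Ω] (P : Measure Ω)
    [IsFiniteMeasure P] {ι : Type*} [TopologicalSpace ι] [FirstCountableTopology ι]
    {u : ι → Ω → ℝ} (hc : ∀ ω, Continuous fun t => u t ω)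
    (hm : ∀ t, Measurable (u t)) {C : ℝ} (hC : ∀ t ω, |u t ω| ≤ C) :
    Continuous fun t => ∫ ω, u t ω ∂P :=
  continuous_of_dominated (fun t => (hm t).aestronglyMeasurable)
    (fun t => Eventually.of_forall (hC t)) (integrable_const C) (Eventually.of_forall hc)

theorem ZeroAtInftyContinuousMap.abs_apply_le {S : Type*} [TopologicalSpace S] (f : C₀(S, ℝ))
    (y : S) : |f y| ≤ ‖f‖ :=
  f.toBCF.norm_coe_le_norm y

theorem integrable_of_abs_le {Ω : Type*} [MeasurableSpace Ω] {P : Measure Ω}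
    [IsFiniteMeasure P] {u : Ω → ℝ} (hm : Measurable u) {C : ℝ} (hC : ∀ ω, |u ω| ≤ C) :
    Integrable u P :=
  Integrable.of_bound hm.aestronglyMeasurable C (Eventually.of_forall hC)

theorem integral_sub_sub {Ω : Type*} [MeasurableSpace Ω] {P : Measure Ω} {a b c : Ω → ℝ}
    (ha : Integrable a P) (hb : Integrable b P) (hc : Integrable c P) :
    ∫ ω, (a ω - b ω - c ω) ∂P = ∫ ω, a ω ∂P - ∫ ω, b ω ∂P - ∫ ω, c ω ∂P :=
  (integral_sub (ha.sub hb) hc).trans (congrArg (· - ∫ ω, c ω ∂P) (integral_sub ha hb))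

/-- Dissipativity of the difference quotient of a contraction, with `G = T t F` and `a = 1 / t`,
before letting `t ↓ 0`. -/
theorem mul_norm_le_norm_smul_sub_smul_sub {E : Type*} [NormedAddCommGroup E] [NormedSpace ℝ E]
    {m a : ℝ} (hm : 0 ≤ m) (ha : 0 ≤ a) {F G : E} (h : ‖G‖ ≤ ‖F‖) :
    m * ‖F‖ ≤ ‖m • F - a • (G - F)‖ := by
  have e : m • F - a • (G - F) = (m + a) • F - a • G := by
    rw [smul_sub, add_smul]; abel
  rw [e]
  refine le_trans ?_ (norm_sub_norm_le _ _)
  rw [norm_smul, norm_smul, Real.norm_of_nonneg (by positivity), Real.norm_of_nonneg ha]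
  have := mul_le_mul_of_nonneg_left h ha
  linarith

/-! ### The Markov property for functions -/

namespace MarkovFamily

section General

variable {M : Type*} [MeasurableSpace M] (X : MarkovFamily M)

theorem processPast_le (x : M) (s : ℝ≥0) : processPast (X.X x) s ≤ X.mΩ x :=
  iSup_le fun u => (X.measurable_X x u).comap_le

theorem measurable_processPast (x : M) {s u : ℝ≥0} (hu : u ≤ s) :
    Measurable[processPast (X.X x) s] (X.X x u) :=
  (comap_measurable _).mono
    (le_iSup (fun u : Set.Iic s => MeasurableSpace.comap (X.X x u) inferInstance) ⟨u, hu⟩) le_rfl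

/-- The transition kernel of a Markov family. -/
noncomputable def transition (t : ℝ≥0) : Kernel M M where
  toFun x := (X.P x).map (X.X x t)
  measurable' := Measure.measurable_of_measurable_coe _ fun B hB => by
    simp_rw [Measure.map_apply (X.measurable_X _ t) hB]
    exact X.measurable_trans t B hB

theorem transition_apply (t : ℝ≥0) (x : M) : X.transition t x = (X.P x).map (X.X x t) := rfl

instance (t : ℝ≥0) : IsMarkovKernel (X.transition t) :=
  ⟨fun x => Measure.isProbabilityMeasure_map (X.measurable_X x t).aemeasurable⟩

theorem integral_transition (t : ℝ≥0) (x : M) {g : M → ℝ} (hg : Measurable g) :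
    ∫ z, g z ∂(X.transition t x) = ∫ ω, g (X.X x t ω) ∂(X.P x) :=
  integral_map (X.measurable_X x t).aemeasurable hg.aestronglyMeasurable

theorem measurable_expectation (t : ℝ≥0) {g : M → ℝ} (hg : Measurable g) :
    Measurable fun x => ∫ ω, g (X.X x t ω) ∂(X.P x) := by
  simp_rw [← X.integral_transition t _ hg]
  exact hg.stronglyMeasurable.integral_kernel.measurable

/-- Integrating the Markov property over a past event `A` yields an identity of measures, which can
then be integrated against functions. -/
theorem map_restrict_eq_bind (x : M) (s t : ℝ≥0) {A : Set (X.Ω x)}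
    (hA : MeasurableSet[processPast (X.X x) s] A) :
    ((X.P x).restrict A).map (X.X x (s + t)) =
      X.transition t ∘ₘ ((X.P x).restrict A).map (X.X x s) := by
  have hA' := X.processPast_le x s A hA
  ext B hB
  have hpre := X.measurable_X x (s + t) hB
  rw [Measure.map_apply (X.measurable_X x (s + t)) hB,
    Measure.bind_apply hB (X.transition t).measurable.aemeasurable,
    lintegral_map ((X.transition t).measurable_coe hB) (X.measurable_X x s)]
  have h1 := setIntegral_condExp (X.processPast_le x s)
    (f := (X.X x (s + t) ⁻¹' B).indicator (fun _ => (1 : ℝ))) (μ := X.P x)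
    ((integrable_const 1).indicator hpre) hA
  rw [setIntegral_congr_ae hA' ((X.markov x s t B hB).mono fun ω h _ => h),
    integral_indicator_const _ hpre, smul_eq_mul, mul_one] at h1
  have h2 : ∀ z, X.transition t z B = ENNReal.ofReal ((X.P z).real (X.X z t ⁻¹' B)) := fun z => by
    rw [transition_apply, Measure.map_apply (X.measurable_X z t) hB, ofReal_measureReal]
  simp_rw [h2]
  rw [← ofReal_integral_eq_lintegral_ofReal, h1, ofReal_measureReal]
  · refine integrable_of_abs_le (C := 1) ?_ fun ω => ?_
    · exact (X.measurable_trans t B hB).ennreal_toReal.comp (X.measurable_X x s)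
    · rw [abs_of_nonneg measureReal_nonneg]
      exact measureReal_le_one
  · exact Eventually.of_forall fun ω => measureReal_nonneg

theorem condExp_comp (x : M) (s t : ℝ≥0) {g : M → ℝ} (hg : Measurable g) {C : ℝ}
    (hC : ∀ z, |g z| ≤ C) :
    (fun ω => ∫ ω', g (X.X (X.X x s ω) t ω') ∂(X.P (X.X x s ω))) =ᵐ[X.P x]
      (X.P x)[fun ω => g (X.X x (s + t) ω) | processPast (X.X x) s] := by
  have hm := X.measurable_expectation t hg
  have hb : ∀ z, |∫ ω', g (X.X z t ω') ∂(X.P z)| ≤ C :=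
    fun z => abs_integral_le_of_bounded _ fun _ => hC _
  refine ae_eq_condExp_of_forall_setIntegral_eq (X.processPast_le x s)
    (integrable_of_abs_le (hg.comp (X.measurable_X x (s + t))) fun ω => hC _)
    (fun A _ _ => (integrable_of_abs_le (hm.comp (X.measurable_X x s))
      fun ω => hb _).integrableOn) (fun A hA _ => ?_)
    (hm.comp (X.measurable_processPast x le_rfl)).stronglyMeasurable.aestronglyMeasurable
  have h1 := integral_map (μ := (X.P x).restrict A) (X.measurable_X x (s + t)).aemeasurable
    hg.aestronglyMeasurable
  have h2 := integral_map (μ := (X.P x).restrict A) (X.measurable_X x s).aemeasurable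
    hm.aestronglyMeasurable
  rw [← h1, ← h2, X.map_restrict_eq_bind x s t hA, Measure.comp_eq_comp_const_apply,
    ProbabilityTheory.Kernel.integral_comp (integrable_of_abs_le hg hC)]
  simp_rw [X.integral_transition t _ hg, Kernel.const_apply]

/-- The Markov property, tested against a bounded function of the past. -/
theorem integral_mul_comp (x : M) (s t : ℝ≥0) {g : M → ℝ} (hg : Measurable g) {C : ℝ}
    (hC : ∀ z, |g z| ≤ C) {Φ : X.Ω x → ℝ} (hΦ : Measurable[processPast (X.X x) s] Φ) {B : ℝ}
    (hB : ∀ ω, |Φ ω| ≤ B) :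
    ∫ ω, Φ ω * g (X.X x (s + t) ω) ∂(X.P x) =
      ∫ ω, Φ ω * ∫ ω', g (X.X (X.X x s ω) t ω') ∂(X.P (X.X x s ω)) ∂(X.P x) := by
  have hgi : Integrable (fun ω => g (X.X x (s + t) ω)) (X.P x) :=
    integrable_of_abs_le (hg.comp (X.measurable_X x (s + t))) fun ω => hC _
  have hΦm : Measurable Φ := hΦ.mono (X.processPast_le x s) le_rfl
  have hmul : Integrable (Φ * fun ω => g (X.X x (s + t) ω)) (X.P x) :=
    hgi.bdd_mul hΦm.aestronglyMeasurable (Eventually.of_forall hB)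
  rw [← integral_condExp (X.processPast_le x s) (f := fun ω => Φ ω * g (X.X x (s + t) ω))]
  refine integral_congr_ae ?_
  filter_upwards [condExp_mul_of_stronglyMeasurable_left hΦ.stronglyMeasurable hmul hgi,
    X.condExp_comp x s t hg hC] with ω h1 h2
  rw [h2]
  exact h1

end General

/-! ### The Dynkin defect -/

section Dynkin

variable {M S : Type*} [MeasurableSpace M] (X : MarkovFamily M)
  [MetricSpace S] {h : M → S}

/-- The expected defect in Dynkin's formula for the pair `(f, g)` along the process `h (X x t)`. -/
noncomputable def dynkinDefect (h : M → S) (f g : C₀(S, ℝ)) (T : ℝ≥0) (x : M) : ℝ :=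
  ∫ ω, (f (h (X.X x T ω)) - f (h (X.X x 0 ω))
    - ∫ t in (0 : ℝ)..T, g (h (X.X x t.toNNReal ω))) ∂(X.P x)

theorem abs_dynkinDefect_le (f g : C₀(S, ℝ)) (T : ℝ≥0) (x : M) :
    |X.dynkinDefect h f g T x| ≤ ‖f‖ + ‖f‖ + ‖g‖ * T := by
  refine abs_integral_le_of_bounded _ fun ω => (abs_sub _ _).trans (add_le_add ?_ ?_)
  · exact (abs_sub _ _).trans (add_le_add (f.abs_apply_le _) (f.abs_apply_le _))
  · exact abs_intervalIntegral_le_of_bounded (fun t => g.abs_apply_le _) T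

variable [MeasurableSpace S] [BorelSpace S]

theorem dynkinDefect_eq (hm : Measurable h) (hc : ∀ x ω, Continuous fun t => h (X.X x t ω))
    (f g : C₀(S, ℝ)) (T : ℝ≥0) (x : M) :
    X.dynkinDefect h f g T x =
      ∫ ω, f (h (X.X x T ω)) ∂(X.P x) - ∫ ω, f (h (X.X x 0 ω)) ∂(X.P x)
        - ∫ t in (0 : ℝ)..T, ∫ ω, g (h (X.X x t.toNNReal ω)) ∂(X.P x) := by
  have hfm : ∀ (f : C₀(S, ℝ)) t, Measurable fun ω => f (h (X.X x t ω)) := fun f t =>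
    f.continuous.measurable.comp (hm.comp (X.measurable_X x t))
  have hfi : ∀ t, Integrable (fun ω => f (h (X.X x t ω))) (X.P x) := fun t =>
    integrable_of_abs_le (hfm f t) fun ω => f.abs_apply_le _
  have hgc : ∀ ω, Continuous fun t : ℝ => g (h (X.X x t.toNNReal ω)) := fun ω =>
    g.continuous.comp ((hc x ω).comp continuous_real_toNNReal)
  have hgi := integrable_of_abs_le (P := X.P x)
    (measurable_intervalIntegral_of_continuous hgc (fun t => hfm g _) 0 T)
    fun ω => abs_intervalIntegral_le_of_bounded (fun t => g.abs_apply_le _) T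
  rw [dynkinDefect, integral_sub_sub (hfi T) (hfi 0) hgi,
    integral_intervalIntegral_of_continuous (X.P x) hgc (fun t => hfm g _)
      (fun t ω => g.abs_apply_le _)]

theorem continuous_expectation (hm : Measurable h) (hc : ∀ x ω, Continuous fun t => h (X.X x t ω))
    (g : C₀(S, ℝ)) (x : M) :
    Continuous fun t => ∫ ω, g (h (X.X x t ω)) ∂(X.P x) :=
  continuous_integral_of_bounded (X.P x) (fun ω => g.continuous.comp (hc x ω))
    (fun t => g.continuous.measurable.comp (hm.comp (X.measurable_X x t)))
    fun _ _ => g.abs_apply_le _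

/-- Restarting at time `s`: the increments of the Dynkin martingale after time `s`, tested against
the past, are the defects of the process started afresh from `X x s`. -/
theorem integral_mul_dynkin (hm : Measurable h) (hc : ∀ x ω, Continuous fun t => h (X.X x t ω))
    (f g : C₀(S, ℝ)) (x : M) (s T : ℝ≥0) {Φ : X.Ω x → ℝ}
    (hΦ : Measurable[processPast (X.X x) s] Φ) {B : ℝ} (hB : ∀ ω, |Φ ω| ≤ B) :
    ∫ ω, Φ ω * (f (h (X.X x (s + T) ω)) - f (h (X.X x s ω))
      - ∫ t in (0 : ℝ)..T, g (h (X.X x (s + t.toNNReal) ω))) ∂(X.P x) =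
    ∫ ω, Φ ω * X.dynkinDefect h f g T (X.X x s ω) ∂(X.P x) := by
  have hΦm : Measurable Φ := hΦ.mono (X.processPast_le x s) le_rfl
  have hfm : ∀ (f : C₀(S, ℝ)) t, Measurable fun ω => f (h (X.X x t ω)) := fun f t =>
    f.continuous.measurable.comp (hm.comp (X.measurable_X x t))
  have hEm : ∀ (g : C₀(S, ℝ)) t, Measurable fun ω =>
      ∫ ω', g (h (X.X (X.X x s ω) t ω')) ∂(X.P (X.X x s ω)) := fun g t =>
    (X.measurable_expectation t (g.continuous.measurable.comp hm)).comp (X.measurable_X x s)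
  have hEb : ∀ (g : C₀(S, ℝ)) t z, |∫ ω', g (h (X.X z t ω')) ∂(X.P z)| ≤ ‖g‖ := fun g t z =>
    abs_integral_le_of_bounded _ fun _ => g.abs_apply_le _
  have hgc : ∀ ω, Continuous fun t : ℝ => g (h (X.X x (s + t.toNNReal) ω)) := fun ω =>
    g.continuous.comp ((hc x ω).comp (continuous_const.add continuous_real_toNNReal))
  have hEc : ∀ ω, Continuous fun t : ℝ =>
      ∫ ω', g (h (X.X (X.X x s ω) t.toNNReal ω')) ∂(X.P (X.X x s ω)) := fun ω =>
    (X.continuous_expectation hm hc g _).comp continuous_real_toNNReal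
  have hbm : ∀ {u : X.Ω x → ℝ} {C : ℝ}, Measurable u → (∀ ω, |u ω| ≤ C) →
      Integrable (fun ω => Φ ω * u ω) (X.P x) := fun hu hC =>
    (integrable_of_abs_le hu hC).bdd_mul hΦm.aestronglyMeasurable (Eventually.of_forall hB)
  have hmk : ∀ (f : C₀(S, ℝ)) t, ∫ ω, Φ ω * f (h (X.X x (s + t) ω)) ∂(X.P x) =
      ∫ ω, Φ ω * ∫ ω', f (h (X.X (X.X x s ω) t ω')) ∂(X.P (X.X x s ω)) ∂(X.P x) := fun f t =>
    X.integral_mul_comp x s t (f.continuous.measurable.comp hm) (fun z => f.abs_apply_le _) hΦ hB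
  have hmul : ∀ (g : C₀(S, ℝ)) ω t, |Φ ω * g (h (X.X x t ω))| ≤ B * ‖g‖ := fun g ω t => by
    rw [abs_mul]
    exact mul_le_mul (hB ω) (g.abs_apply_le _) (abs_nonneg _) ((abs_nonneg _).trans (hB ω))
  have hI : ∫ ω, Φ ω * (∫ t in (0 : ℝ)..T, g (h (X.X x (s + t.toNNReal) ω))) ∂(X.P x) =
      ∫ ω, Φ ω * (∫ t in (0 : ℝ)..T,
        ∫ ω', g (h (X.X (X.X x s ω) t.toNNReal ω')) ∂(X.P (X.X x s ω))) ∂(X.P x) := by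
    simp_rw [← intervalIntegral.integral_const_mul]
    rw [integral_intervalIntegral_of_continuous (X.P x)
        (u := fun t ω => Φ ω * g (h (X.X x (s + t.toNNReal) ω)))
        (fun ω => continuous_const.mul (hgc ω)) (fun t => hΦm.mul (hfm g _)) (C := B * ‖g‖)
        (fun t ω => hmul g ω _),
      integral_intervalIntegral_of_continuous (X.P x)
        (u := fun t ω => Φ ω *
          ∫ ω', g (h (X.X (X.X x s ω) t.toNNReal ω')) ∂(X.P (X.X x s ω)))
        (fun ω => continuous_const.mul (hEc ω)) (fun t => hΦm.mul (hEm g _)) (C := B * ‖g‖)]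
    · simp_rw [hmk]
    · intro t ω
      rw [abs_mul]
      exact mul_le_mul (hB ω) (hEb _ _ _) (abs_nonneg _) ((abs_nonneg _).trans (hB ω))
  -- The defect contains the expectation of `f` at time zero of the restarted process, so the term
  -- at time `s` also goes through the Markov property, with elapsed time `0`.
  have h0 := hmk f 0
  rw [add_zero] at h0
  simp_rw [X.dynkinDefect_eq hm hc, mul_sub]
  have i1 := hbm (hfm f (s + T)) fun ω => f.abs_apply_le _
  have i2 := hbm (hfm f s) fun ω => f.abs_apply_le _
  have i3 := hbm (measurable_intervalIntegral_of_continuous hgc (fun t => hfm g _) 0 T)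
    fun ω => abs_intervalIntegral_le_of_bounded (fun t => g.abs_apply_le _) T
  have j1 := hbm (hEm f T) fun ω => hEb f T _
  have j2 := hbm (hEm f 0) fun ω => hEb f 0 _
  have j3 := hbm (measurable_intervalIntegral_of_continuous hEc (fun t => hEm g _) 0 T)
    fun ω => abs_intervalIntegral_le_of_bounded (fun t => hEb g _ _) T
  rw [integral_sub_sub i1 i2 i3, integral_sub_sub j1 j2 j3, hmk f T, h0, hI]

end Dynkin

/-! ### Dynkin's formula for a Feller family -/

section Feller

variable {S : Type*} [MetricSpace S] [MeasurableSpace S] [BorelSpace S] (Y : MarkovFamily S)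
  (hY : Y.PreservesC0)

theorem norm_semigroup_le (t : ℝ≥0) (f : C₀(S, ℝ)) : ‖Y.semigroup hY t f‖ ≤ ‖f‖ := by
  change ‖(Y.semigroup hY t f).toBCF‖ ≤ ‖f‖
  refine (BoundedContinuousFunction.norm_le (norm_nonneg f)).2 fun y => ?_
  change |Y.semigroup hY t f y| ≤ ‖f‖
  rw [Y.semigroup_apply]
  exact abs_integral_le_of_bounded _ fun _ => f.abs_apply_le _

theorem semigroup_zero (f : C₀(S, ℝ)) : Y.semigroup hY 0 f = f := by
  ext y
  rw [Y.semigroup_apply, integral_congr_ae (g := fun _ => f y)]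
  · simp
  · filter_upwards [Y.start y] with ω hω
    rw [hω]

theorem semigroup_add (s t : ℝ≥0) (f : C₀(S, ℝ)) :
    Y.semigroup hY (s + t) f = Y.semigroup hY s (Y.semigroup hY t f) := by
  ext y
  have := Y.integral_mul_comp y s t (g := f) f.continuous.measurable f.abs_apply_le
    (Φ := fun _ => 1) measurable_const (B := 1) (by simp)
  simp only [one_mul] at this
  rw [Y.semigroup_apply, this, Y.semigroup_apply]
  simp_rw [Y.semigroup_apply]

theorem tendsto_generator (F : (Y.generator hY).domain) :
    Tendsto (fun t : ℝ≥0 => (t : ℝ)⁻¹ • (Y.semigroup hY t F - F)) (𝓝[>] 0)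
      (𝓝 (Y.generator hY F)) :=
  F.2.choose_spec

/-- The generator of a contraction semigroup is dissipative. -/
theorem mul_norm_le_norm_smul_sub_generator {m : ℝ} (hm : 0 < m)
    (F : (Y.generator hY).domain) :
    m * ‖(F : C₀(S, ℝ))‖ ≤ ‖m • (F : C₀(S, ℝ)) - Y.generator hY F‖ := by
  refine ge_of_tendsto ((tendsto_const_nhds.sub (Y.tendsto_generator hY F)).norm) ?_
  filter_upwards [self_mem_nhdsWithin] with t ht
  have ht' : (0 : ℝ) < t := ht
  exact mul_norm_le_norm_smul_sub_smul_sub hm.le (inv_pos.2 ht').le (Y.norm_semigroup_le hY t F)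

theorem continuous_semigroup_apply (hYc : ∀ y ω, Continuous fun t => Y.X y t ω) (f : C₀(S, ℝ))
    (y : S) : Continuous fun t => Y.semigroup hY t f y := by
  simp_rw [Y.semigroup_apply]
  exact Y.continuous_expectation measurable_id hYc f y

/-- From `T (t + r) F - T t F = T t (T r F - F)` and contractivity, `T t (AF) y` is the right
derivative of `T t F y`. A right derivative suffices since path continuity makes both functions
continuous in `t`; strong continuity of the semigroup is not needed. -/
theorem semigroup_sub_eq_integral (hYc : ∀ y ω, Continuous fun t => Y.X y t ω)
    (F : (Y.generator hY).domain) (T : ℝ≥0) (y : S) :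
    ∫ t in (0 : ℝ)..T, Y.semigroup hY t.toNNReal (Y.generator hY F) y =
      Y.semigroup hY T F y - (F : C₀(S, ℝ)) y := by
  have hcont : ∀ f : C₀(S, ℝ), Continuous fun t : ℝ => Y.semigroup hY t.toNNReal f y := fun f =>
    (Y.continuous_semigroup_apply hY hYc f y).comp continuous_real_toNNReal
  rw [intervalIntegral.integral_eq_sub_of_hasDeriv_right_of_le T.coe_nonneg
    (f := fun t : ℝ => Y.semigroup hY t.toNNReal F y)
    (f' := fun t : ℝ => Y.semigroup hY t.toNNReal (Y.generator hY F) y) (hcont F).continuousOn ?_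
    ((hcont _).intervalIntegrable _ _)]
  · simp [Y.semigroup_zero]
  intro t ht
  rw [hasDerivWithinAt_iff_tendsto_slope' (by simp)]
  have hshift : Tendsto (fun r : ℝ => (r - t).toNNReal) (𝓝[>] t) (𝓝[>] 0) := by
    refine tendsto_nhdsWithin_iff.2 ⟨?_, ?_⟩
    · have : Continuous fun r : ℝ => (r - t).toNNReal := by fun_prop
      have h := this.tendsto t
      simp only [sub_self, Real.toNNReal_zero] at h
      exact h.mono_left nhdsWithin_le_nhds
    · filter_upwards [self_mem_nhdsWithin] with r hr
      simpa using hr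
  have hlim := (Y.tendsto_generator hY F).comp hshift
  rw [tendsto_iff_norm_sub_tendsto_zero] at hlim ⊢
  refine squeeze_zero' (Eventually.of_forall fun _ => norm_nonneg _) ?_ hlim
  filter_upwards [self_mem_nhdsWithin] with r hr
  have hr' : t < r := hr
  have hsum : r.toNNReal = t.toNNReal + (r - t).toNNReal := by
    rw [← Real.toNNReal_add ht.1.le (by linarith)]
    congr 1; ring
  have hrt : (((r - t).toNNReal : ℝ≥0) : ℝ) = r - t := Real.coe_toNNReal _ (by linarith)
  refine le_trans (le_of_eq ?_) ((ZeroAtInftyContinuousMap.abs_apply_le _ y).trans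
    (Y.norm_semigroup_le hY t.toNNReal _))
  rw [map_sub, Function.comp_apply, map_smul, map_sub, hrt]
  simp only [slope, hsum, Y.semigroup_add]
  simp [Real.norm_eq_abs]

theorem dynkinDefect_generator (hYc : ∀ y ω, Continuous fun t => Y.X y t ω)
    (F : (Y.generator hY).domain) (T : ℝ≥0) (y : S) :
    Y.dynkinDefect id (F : C₀(S, ℝ)) (Y.generator hY F) T y = 0 := by
  rw [Y.dynkinDefect_eq measurable_id hYc]
  have := Y.semigroup_sub_eq_integral hY hYc F T y
  simp only [id, ← Y.semigroup_apply hY] at this ⊢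
  rw [this, Y.semigroup_zero, sub_self]

end Feller

end MarkovFamily

/-! ### Cylinder functions -/

section Cylinder

open scoped BoundedContinuousFunction

variable {S : Type*} [MetricSpace S]

/-- The product of the functions `p.2` evaluated along the path `w` at the times `p.1`, `p ∈ l`. -/
def cylinderProd (l : List (ℝ≥0 × (S →ᵇ ℝ))) (w : ℝ≥0 → S) : ℝ :=
  (l.map fun p => p.2 (w p.1)).prod

theorem cylinderProd_nil (w : ℝ≥0 → S) : cylinderProd [] w = 1 := rfl

theorem cylinderProd_cons (p : ℝ≥0 × (S →ᵇ ℝ)) (l : List (ℝ≥0 × (S →ᵇ ℝ))) (w : ℝ≥0 → S) :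
    cylinderProd (p :: l) w = p.2 (w p.1) * cylinderProd l w := by
  simp [cylinderProd]

theorem cylinderProd_perm {l l' : List (ℝ≥0 × (S →ᵇ ℝ))} (h : l.Perm l') (w : ℝ≥0 → S) :
    cylinderProd l w = cylinderProd l' w :=
  (h.map _).prod_eq

theorem exists_abs_cylinderProd_le (l : List (ℝ≥0 × (S →ᵇ ℝ))) :
    ∃ B, ∀ w, |cylinderProd l w| ≤ B := by
  induction l with
  | nil => exact ⟨1, fun w => by simp [cylinderProd_nil]⟩
  | cons p l ih =>
    obtain ⟨B, hB⟩ := ih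
    refine ⟨‖p.2‖ * B, fun w => ?_⟩
    rw [cylinderProd_cons, abs_mul]
    exact mul_le_mul (p.2.norm_coe_le_norm _) (hB w) (abs_nonneg _) (norm_nonneg _)

theorem continuous_cylinderProd (l : List (ℝ≥0 × (S →ᵇ ℝ))) :
    Continuous fun w : C(ℝ≥0, S) => cylinderProd l w := by
  induction l with
  | nil => exact continuous_const
  | cons p l ih =>
    simp_rw [cylinderProd_cons]
    exact (p.2.continuous.comp (continuous_eval_const p.1)).mul ih

theorem measurable_cylinderProd [MeasurableSpace S] [BorelSpace S] {Ω : Type*}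
    {m : MeasurableSpace Ω} {Z : ℝ≥0 → Ω → S} (l : List (ℝ≥0 × (S →ᵇ ℝ)))
    (hZ : ∀ p ∈ l, Measurable (Z p.1)) : Measurable fun ω => cylinderProd l fun t => Z t ω := by
  induction l with
  | nil => exact measurable_const
  | cons p l ih =>
    simp_rw [cylinderProd_cons]
    exact (p.2.continuous.measurable.comp (hZ p List.mem_cons_self)).mul
      (ih fun q hq => hZ q (List.mem_cons_of_mem _ hq))

end Cylinder

/-! ### The martingale problem -/

section MartingaleProblem

open scoped BoundedContinuousFunction

variable {S : Type*} [MetricSpace S]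

/-- The increment over `[s, s + T]` of the process `f (w t) - ∫₀ᵗ g (w r) dr`, weighted by a cylinder
function. -/
noncomputable def dynkinIncrement (l : List (ℝ≥0 × (S →ᵇ ℝ))) (f g : C₀(S, ℝ)) (s T : ℝ≥0)
    (w : ℝ≥0 → S) : ℝ :=
  cylinderProd l w * (f (w (s + T)) - f (w s) - ∫ t in (0 : ℝ)..T, g (w (s + t.toNNReal)))

theorem continuous_dynkinIncrement (l : List (ℝ≥0 × (S →ᵇ ℝ))) (f g : C₀(S, ℝ)) (s T : ℝ≥0) :
    Continuous fun w : C(ℝ≥0, S) => dynkinIncrement l f g s T w := by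
  have hev : ∀ r : ℝ≥0, Continuous fun w : C(ℝ≥0, S) => f (w r) := fun r =>
    f.continuous.comp (continuous_eval_const r)
  refine (continuous_cylinderProd l).mul (((hev _).sub (hev _)).sub ?_)
  refine intervalIntegral.continuous_parametric_intervalIntegral_of_continuous'
    (f := fun (w : C(ℝ≥0, S)) t => g (w (s + t.toNNReal))) ?_ _ _
  refine g.continuous.comp ?_
  exact continuous_fst.eval
    (continuous_const.add (continuous_real_toNNReal.comp continuous_snd))

theorem exists_abs_dynkinIncrement_le (l : List (ℝ≥0 × (S →ᵇ ℝ))) (f g : C₀(S, ℝ))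
    (s T : ℝ≥0) : ∃ B, ∀ w, |dynkinIncrement l f g s T w| ≤ B := by
  obtain ⟨B, hB⟩ := exists_abs_cylinderProd_le l
  refine ⟨B * (‖f‖ + ‖f‖ + ‖g‖ * T), fun w => ?_⟩
  rw [dynkinIncrement, abs_mul]
  refine mul_le_mul (hB w) ?_ (abs_nonneg _) ((abs_nonneg _).trans (hB w))
  refine (abs_sub _ _).trans (add_le_add ?_ ?_)
  · exact (abs_sub _ _).trans (add_le_add (f.abs_apply_le _) (f.abs_apply_le _))
  · exact abs_intervalIntegral_le_of_bounded (fun t => g.abs_apply_le _) T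

/-- Under `μ`, the process `f (w t) - ∫₀ᵗ g (w r) dr` is a martingale, in the sense that its
increments are orthogonal to all cylinder functions of the past. -/
def SolvesMartingaleProblem (μ : Measure C(ℝ≥0, S)) (f g : C₀(S, ℝ)) : Prop :=
  ∀ (l : List (ℝ≥0 × (S →ᵇ ℝ))) (s T : ℝ≥0), (∀ p ∈ l, p.1 ≤ s) →
    ∫ w, dynkinIncrement l f g s T w ∂μ = 0

/-- Allows a cylinder factor at the current time to be absorbed into the test function. -/
theorem exists_zeroAtInfty_eq_mul (g : S →ᵇ ℝ) (f : C₀(S, ℝ)) :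
    ∃ k : C₀(S, ℝ), ∀ y, k y = g y * f y := by
  refine ⟨⟨⟨fun y => g y * f y, g.continuous.mul f.continuous⟩, ?_⟩, fun _ => rfl⟩
  refine squeeze_zero_norm (a := fun y => ‖g‖ * ‖f y‖) (fun y => ?_) ?_
  · rw [norm_mul]
    gcongr
    exact g.norm_coe_le_norm y
  · simpa using (zero_at_infty f).norm.const_mul ‖g‖

theorem exists_seq_zeroAtInfty_tendsto_one [LocallyCompactSpace S] [SigmaCompactSpace S] :
    ∃ f : ℕ → C₀(S, ℝ), (∀ n y, |f n y| ≤ 1) ∧ ∀ y, Tendsto (fun n => f n y) atTop (𝓝 1) := by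
  let K := CompactExhaustion.choice S
  have hex : ∀ n, ∃ f : C₀(S, ℝ), (∀ y ∈ K n, f y = 1) ∧ ∀ y, |f y| ≤ 1 := fun n => by
    obtain ⟨f, h1, -, hc, hf⟩ :=
      exists_continuous_one_zero_of_isCompact (K.isCompact n) isClosed_empty (by simp)
    exact ⟨⟨f, hc.is_zero_at_infty⟩, fun y hy => h1 hy,
      fun y => abs_le.2 ⟨(neg_nonpos.2 zero_le_one).trans (hf y).1, (hf y).2⟩⟩
  choose f hf1 hfb using hex
  refine ⟨f, hfb, fun y => tendsto_const_nhds.congr' ?_⟩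
  filter_upwards [eventually_ge_atTop (K.find y)] with n hn
  exact (hf1 n y (K.subset hn (K.mem_find y))).symm

variable [MeasurableSpace S] [BorelSpace S]

theorem measurable_eval_path (t : ℝ≥0) : Measurable fun w : C(ℝ≥0, S) => w t :=
  (continuous_eval_const t).measurable

/-! ### Uniqueness for the martingale problem -/

section Uniqueness

variable {E : Type*} [AddCommMonoid E] [Module ℝ E] (i A : E →ₗ[ℝ] C₀(S, ℝ))
  {μ ν : Measure C(ℝ≥0, S)} [IsProbabilityMeasure μ] [IsProbabilityMeasure ν]

/-- Fubini turns the martingale problem into a forward equation for expectations weighted by a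
function of the past. -/
theorem integral_cylinderProd_mul_sub_eq (l : List (ℝ≥0 × (S →ᵇ ℝ))) (f g : C₀(S, ℝ))
    (hμ : SolvesMartingaleProblem μ f g) (s T : ℝ≥0) (hs : ∀ p ∈ l, p.1 ≤ s) :
    ∫ w, cylinderProd l w * f (w (s + T)) ∂μ - ∫ w, cylinderProd l w * f (w s) ∂μ =
      ∫ t in (0 : ℝ)..T, ∫ w, cylinderProd l w * g (w (s + t.toNNReal)) ∂μ := by
  obtain ⟨B, hB⟩ := exists_abs_cylinderProd_le l
  have hΦm : Measurable fun w : C(ℝ≥0, S) => cylinderProd l w :=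
    (continuous_cylinderProd l).measurable
  have hfm : ∀ (f : C₀(S, ℝ)) t, Measurable fun w : C(ℝ≥0, S) => f (w t) := fun f t =>
    f.continuous.measurable.comp (measurable_eval_path t)
  have hgc : ∀ w : C(ℝ≥0, S), Continuous fun t : ℝ => g (w (s + t.toNNReal)) := fun w =>
    g.continuous.comp (w.continuous.comp (continuous_const.add continuous_real_toNNReal))
  have hbm : ∀ {u : C(ℝ≥0, S) → ℝ} {C : ℝ}, Measurable u → (∀ w, |u w| ≤ C) →
      Integrable (fun w : C(ℝ≥0, S) => cylinderProd l w * u w) μ := fun hu hC =>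
    (integrable_of_abs_le hu hC).bdd_mul hΦm.aestronglyMeasurable
      (Eventually.of_forall fun w => hB w)
  have h0 := hμ l s T hs
  simp only [dynkinIncrement, mul_sub] at h0
  rw [integral_sub_sub (hbm (hfm f (s + T)) fun w => f.abs_apply_le _)
    (hbm (hfm f s) fun w => f.abs_apply_le _)
    (hbm (measurable_intervalIntegral_of_continuous hgc (fun t => hfm g _) 0 T)
    fun ω => abs_intervalIntegral_le_of_bounded (fun t => g.abs_apply_le _) T)] at h0
  simp_rw [← intervalIntegral.integral_const_mul] at h0
  rw [integral_intervalIntegral_of_continuous μ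
    (u := fun t (w : C(ℝ≥0, S)) => cylinderProd l w * g (w (s + t.toNNReal)))
    (fun w => continuous_const.mul (hgc w)) (fun t => hΦm.mul (hfm g _)) (C := B * ‖g‖)] at h0
  · linarith
  · intro t w
    rw [abs_mul]
    exact mul_le_mul (hB w) (g.abs_apply_le _) (abs_nonneg _) ((abs_nonneg _).trans (hB w))

/-- The difference of the two weighted functionals after time `s` starts at zero and solves the
forward equation, hence vanishes. The weight may change sign, so these are signed functionals rather
than probability laws. -/
theorem integral_cylinderProd_mul_eq_of_initial
    (hdiss : ∀ m : ℝ, 0 < m → ∀ F, m * ‖i F‖ ≤ ‖m • i F - A F‖)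
    {c : ℝ} (hc : 0 < c) (hd : DenseRange fun F => c • i F - A F)
    (hμ : ∀ F, SolvesMartingaleProblem μ (i F) (A F))
    (hν : ∀ F, SolvesMartingaleProblem ν (i F) (A F))
    (l : List (ℝ≥0 × (S →ᵇ ℝ))) (s : ℝ≥0) (hs : ∀ p ∈ l, p.1 ≤ s)
    (h0 : ∀ f : C₀(S, ℝ),
      ∫ w, cylinderProd l w * f (w s) ∂μ = ∫ w, cylinderProd l w * f (w s) ∂ν)
    (r : ℝ≥0) (f : C₀(S, ℝ)) :
    ∫ w, cylinderProd l w * f (w (s + r)) ∂μ = ∫ w, cylinderProd l w * f (w (s + r)) ∂ν := by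
  obtain ⟨B, hB⟩ := exists_abs_cylinderProd_le l
  have hΦm : Measurable fun w : C(ℝ≥0, S) => cylinderProd l w :=
    (continuous_cylinderProd l).measurable
  have hfm : ∀ (f : C₀(S, ℝ)) t, Measurable fun w : C(ℝ≥0, S) => cylinderProd l w * f (w t) :=
    fun f t => hΦm.mul (f.continuous.measurable.comp (measurable_eval_path t))
  have hfb : ∀ (f : C₀(S, ℝ)) t (w : C(ℝ≥0, S)), |cylinderProd l w * f (w t)| ≤ B * ‖f‖ :=
    fun f t w => by
      rw [abs_mul]
      exact mul_le_mul (hB w) (f.abs_apply_le _) (abs_nonneg _) ((abs_nonneg _).trans (hB w))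
  have hfi : ∀ (ρ : Measure C(ℝ≥0, S)) [IsProbabilityMeasure ρ] (f : C₀(S, ℝ)) t,
      Integrable (fun w : C(ℝ≥0, S) => cylinderProd l w * f (w t)) ρ := fun ρ _ f t =>
    integrable_of_abs_le (hfm f t) (hfb f t)
  let V (ρ : Measure C(ℝ≥0, S)) [IsProbabilityMeasure ρ] (t : ℝ≥0) : C₀(S, ℝ) →ₗ[ℝ] ℝ :=
    { toFun := fun f => ∫ w, cylinderProd l w * f (w t) ∂ρ
      map_add' := fun f g => by
        rw [← integral_add (hfi ρ f t) (hfi ρ g t)]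
        congr with w
        exact mul_add _ _ _
      map_smul' := fun a f => by
        rw [RingHom.id_apply, smul_eq_mul, ← integral_const_mul]
        congr with w
        exact mul_left_comm _ _ _ }
  have hVb : ∀ (ρ : Measure C(ℝ≥0, S)) [IsProbabilityMeasure ρ] t f, |V ρ t f| ≤ B * ‖f‖ :=
    fun ρ _ t f => abs_integral_le_of_bounded ρ (hfb f t)
  have hVc : ∀ (ρ : Measure C(ℝ≥0, S)) [IsProbabilityMeasure ρ] f,
      Continuous fun t => V ρ t f := fun ρ _ f =>
    continuous_integral_of_bounded ρ
      (fun w => continuous_const.mul (f.continuous.comp w.continuous)) (hfm f) (hfb f)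
  let N : ℝ → C₀(S, ℝ) →ₗ[ℝ] ℝ := fun t => V μ (s + t.toNNReal) - V ν (s + t.toNNReal)
  have hshift : Continuous fun t : ℝ => s + t.toNNReal :=
    continuous_const.add continuous_real_toNNReal
  have hNc : ∀ f, Continuous fun t => N t f := fun f =>
    ((hVc μ f).comp hshift).sub ((hVc ν f).comp hshift)
  have key := eq_zero_of_forward_equation i A hdiss hc hd N (C := B + B)
    (fun t f => by
      rw [add_mul]
      exact (abs_sub _ _).trans (add_le_add (hVb μ _ f) (hVb ν _ f))) hNc
    (fun f => by
      simp only [N, Real.toNNReal_zero, add_zero, LinearMap.sub_apply]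
      exact sub_eq_zero.2 (h0 f))
    (fun F T hT => by
      lift T to ℝ≥0 using hT
      have e1 := integral_cylinderProd_mul_sub_eq l (i F) (A F) (hμ F) s T hs
      have e2 := integral_cylinderProd_mul_sub_eq l (i F) (A F) (hν F) s T hs
      have e3 := h0 (i F)
      have e4 : ∫ t in (0 : ℝ)..T, N t (A F) =
          (∫ t in (0 : ℝ)..T, V μ (s + t.toNNReal) (A F)) -
            ∫ t in (0 : ℝ)..T, V ν (s + t.toNNReal) (A F) :=
        intervalIntegral.integral_sub (((hVc μ _).comp hshift).intervalIntegrable _ _)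
          (((hVc ν _).comp hshift).intervalIntegrable _ _)
      rw [e4]
      simp only [N, Real.toNNReal_coe, LinearMap.sub_apply]
      change _ = (∫ t in (0 : ℝ)..T, ∫ w, cylinderProd l w * A F (w (s + t.toNNReal)) ∂μ) -
        ∫ t in (0 : ℝ)..T, ∫ w, cylinderProd l w * A F (w (s + t.toNNReal)) ∂ν
      rw [← e1, ← e2, e3]
      exact (sub_sub_sub_cancel_right _ _ _).symm)
    r.coe_nonneg f
  simp only [N, Real.toNNReal_coe, LinearMap.sub_apply] at key
  exact sub_eq_zero.1 key

/-- Induction over the times, latest first: the factor at the latest time merges with the test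
function, which is covered by the shorter list, and agreement is then propagated from that time to
`s`. -/
theorem integral_cylinderProd_mul_eq
    (hdiss : ∀ m : ℝ, 0 < m → ∀ F, m * ‖i F‖ ≤ ‖m • i F - A F‖)
    {c : ℝ} (hc : 0 < c) (hd : DenseRange fun F => c • i F - A F)
    (hμ : ∀ F, SolvesMartingaleProblem μ (i F) (A F))
    (hν : ∀ F, SolvesMartingaleProblem ν (i F) (A F))
    (h0 : ∀ f : C₀(S, ℝ), ∫ w, f (w 0) ∂μ = ∫ w, f (w 0) ∂ν)
    (l : List (ℝ≥0 × (S →ᵇ ℝ))) (hl : l.Pairwise fun p q => q.1 ≤ p.1)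
    (s : ℝ≥0) (hs : ∀ p ∈ l, p.1 ≤ s) (f : C₀(S, ℝ)) :
    ∫ w, cylinderProd l w * f (w s) ∂μ = ∫ w, cylinderProd l w * f (w s) ∂ν := by
  induction l generalizing s f with
  | nil =>
    have := integral_cylinderProd_mul_eq_of_initial i A hdiss hc hd hμ hν [] 0 (by simp)
      (by simpa [cylinderProd_nil] using h0) s f
    simpa using this
  | cons p l ih =>
    rw [List.pairwise_cons] at hl
    obtain ⟨r, rfl⟩ := exists_add_of_le (hs p List.mem_cons_self)
    refine integral_cylinderProd_mul_eq_of_initial i A hdiss hc hd hμ hν (p :: l) p.1 ?_ ?_ r f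
    · intro q hq
      rcases List.mem_cons.1 hq with rfl | hq
      exacts [le_rfl, hl.1 q hq]
    · intro f
      obtain ⟨k, hk⟩ := exists_zeroAtInfty_eq_mul p.2 f
      have := ih hl.2 p.1 hl.1 k
      simpa only [hk, cylinderProd_cons, mul_left_comm, mul_assoc, mul_comm] using this

theorem integral_cylinderProd_eq [LocallyCompactSpace S] [SigmaCompactSpace S]
    (hdiss : ∀ m : ℝ, 0 < m → ∀ F, m * ‖i F‖ ≤ ‖m • i F - A F‖)
    {c : ℝ} (hc : 0 < c) (hd : DenseRange fun F => c • i F - A F)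
    (hμ : ∀ F, SolvesMartingaleProblem μ (i F) (A F))
    (hν : ∀ F, SolvesMartingaleProblem ν (i F) (A F))
    (h0 : ∀ f : C₀(S, ℝ), ∫ w, f (w 0) ∂μ = ∫ w, f (w 0) ∂ν)
    (l : List (ℝ≥0 × (S →ᵇ ℝ))) :
    ∫ w, cylinderProd l w ∂μ = ∫ w, cylinderProd l w ∂ν := by
  let rel : ℝ≥0 × (S →ᵇ ℝ) → ℝ≥0 × (S →ᵇ ℝ) → Prop := fun p q => q.1 ≤ p.1
  classical
  have : Std.Total rel := ⟨fun p q => le_total q.1 p.1⟩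
  have : IsTrans _ rel := ⟨fun p q r h h' => le_trans h' h⟩
  have hperm := l.perm_insertionSort rel
  simp_rw [← cylinderProd_perm hperm]
  have hsort := l.pairwise_insertionSort rel
  set l' := l.insertionSort rel
  obtain ⟨s, hs⟩ : ∃ s, ∀ p ∈ l', p.1 ≤ s :=
    ⟨(l'.toFinset.image Prod.fst).sup id, fun p hp =>
      Finset.le_sup (f := id) (Finset.mem_image_of_mem _ (List.mem_toFinset.2 hp))⟩
  -- The constant `1` need not lie in `C₀(S, ℝ)`, so the extra test function is removed by dominated
  -- convergence along cutoffs.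
  obtain ⟨f, hf1, hf⟩ := exists_seq_zeroAtInfty_tendsto_one (S := S)
  obtain ⟨B, hB⟩ := exists_abs_cylinderProd_le l'
  have hlim : ∀ (ρ : Measure C(ℝ≥0, S)) [IsProbabilityMeasure ρ],
      Tendsto (fun n => ∫ w, cylinderProd l' w * f n (w s) ∂ρ) atTop
        (𝓝 (∫ w, cylinderProd l' w ∂ρ)) := by
    intro ρ _
    refine tendsto_integral_of_dominated_convergence (fun _ => B) (fun n => ?_)
      (integrable_const _) (fun n => Eventually.of_forall fun w => ?_)
      (Eventually.of_forall fun w => ?_)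
    · exact ((continuous_cylinderProd l').mul ((f n).continuous.comp
        (continuous_eval_const s))).measurable.aestronglyMeasurable
    · rw [Real.norm_eq_abs, abs_mul]
      calc _ ≤ B * 1 := mul_le_mul (hB w) (hf1 n _) (abs_nonneg _) ((abs_nonneg _).trans (hB w))
        _ = B := mul_one B
    · simpa using (hf (w s)).const_mul (cylinderProd l' w)
  refine tendsto_nhds_unique (hlim μ) ((hlim ν).congr fun n => ?_)
  exact (integral_cylinderProd_mul_eq i A hdiss hc hd hμ hν h0 l' hsort s hs (f n)).symm

end Uniqueness

/-- A finite measure on a finite product is determined by the integrals of products of bounded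
continuous functions of the coordinates. -/
theorem ext_of_integral_prod_eval {J : Type*} [Fintype J] {μ ν : Measure (J → S)}
    [IsFiniteMeasure μ] [IsFiniteMeasure ν]
    (h : ∀ φ : J → S →ᵇ ℝ, ∫ x, ∏ j, φ j (x j) ∂μ = ∫ x, ∏ j, φ j (x j) ∂ν) : μ = ν := by
  -- A dummy `Unit` factor fits the criterion for measures on a finite product times one further
  -- space.
  have hm : Measurable fun x : J → S => (x, ()) := by fun_prop
  suffices hu : μ.map (fun x => (x, ())) = ν.map (fun x => (x, ())) by
    have := congrArg (Measure.map Prod.fst) hu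
    rwa [Measure.map_map measurable_fst hm, Measure.map_map measurable_fst hm, Function.comp_def,
      Measure.map_id', Measure.map_id'] at this
  refine Measure.ext_of_integral_prod_mul_boundedContinuousFunction fun φ g => ?_
  have hφ : Measurable fun p : (J → S) × Unit => (∏ j, φ j (p.1 j)) * g p.2 := by
    refine Measurable.mul (Finset.measurable_prod _ fun j _ => ?_)
      (g.continuous.measurable.comp measurable_snd)
    exact (φ j).continuous.measurable.comp ((measurable_pi_apply j).comp measurable_fst)
  rw [integral_map hm.aemeasurable hφ.aestronglyMeasurable,
    integral_map hm.aemeasurable hφ.aestronglyMeasurable]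
  simp only [integral_mul_const, h φ]

/-- A measure on the path space is determined by the integrals of cylinder functions. -/
theorem ext_of_integral_cylinderProd [TopologicalSpace.SeparableSpace S]
    {μ ν : Measure C(ℝ≥0, S)} [IsProbabilityMeasure μ] [IsProbabilityMeasure ν]
    (h : ∀ l : List (ℝ≥0 × (S →ᵇ ℝ)), ∫ w, cylinderProd l w ∂μ = ∫ w, cylinderProd l w ∂ν) :
    μ = ν := by
  let coe : C(ℝ≥0, S) → ℝ≥0 → S := fun w => w
  have hcoe : Measurable coe := measurable_pi_lambda _ measurable_eval_path
  -- The Borel sets of path space are generated by evaluations: `measurable_path` is applied to the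
  -- canonical process under the coordinate σ-algebra.
  have hle : (pathMeasurableSpace : MeasurableSpace C(ℝ≥0, S)) ≤
      MeasurableSpace.comap coe MeasurableSpace.pi := by
    have := @measurable_path S _ _ _ _ C(ℝ≥0, S) (MeasurableSpace.comap coe MeasurableSpace.pi)
      (fun t w => w t) (fun t => (measurable_pi_apply t).comp (comap_measurable coe))
      (fun w => w.continuous)
    exact fun B hB => this hB
  have hmap : μ.map coe = ν.map coe := by
    have := Measure.isProbabilityMeasure_map (μ := μ) hcoe.aemeasurable
    have := Measure.isProbabilityMeasure_map (μ := ν) hcoe.aemeasurable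
    have : ∀ J : Finset ℝ≥0, IsFiniteMeasure ((ν.map coe).map J.restrict) := fun J =>
      inferInstance
    refine IsProjectiveLimit.unique (P := fun J => (ν.map coe).map J.restrict) (fun J => ?_)
      fun J => rfl
    refine ext_of_integral_prod_eval fun φ => ?_
    have hφ : Measurable fun x : J → S => ∏ j, φ j (x j) :=
      Finset.measurable_prod _ fun j _ => (φ j).continuous.measurable.comp (measurable_pi_apply j)
    have hr : Measurable (J.restrict : (ℝ≥0 → S) → J → S) := J.measurable_restrict
    have hcyl : ∀ w : C(ℝ≥0, S), ∏ j : J, φ j (J.restrict (coe w) j) =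
        cylinderProd ((Finset.univ : Finset J).toList.map fun j : J => ((j : ℝ≥0), φ j)) w := fun w => by
      rw [cylinderProd, List.map_map, Finset.prod_map_toList]
      rfl
    beta_reduce
    rw [Measure.map_map hr hcoe, Measure.map_map hr hcoe,
      integral_map (hr.comp hcoe).aemeasurable hφ.aestronglyMeasurable,
      integral_map (hr.comp hcoe).aemeasurable hφ.aestronglyMeasurable]
    simp only [Function.comp_apply]
    simp_rw [hcyl]
    exact h _
  ext B hB
  obtain ⟨B', hB', rfl⟩ := hle B hB
  rw [← Measure.map_apply hcoe hB', hmap, Measure.map_apply hcoe hB']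

end MartingaleProblem

/-! ### Laws of the processes and their limit points -/

section PathLawIntegral

variable {S : Type*} [MetricSpace S] [TopologicalSpace.SeparableSpace S]
  [MeasurableSpace S] [BorelSpace S] {Ω : Type*} [MeasurableSpace Ω]

theorem integral_pathLaw (P : Measure Ω) [IsProbabilityMeasure P] (Z : ℝ≥0 → Ω → S)
    (hm : ∀ t, Measurable (Z t)) (hc : ∀ ω, Continuous fun t => Z t ω) {G : C(ℝ≥0, S) → ℝ}
    (hG : Continuous G) :
    ∫ w, G w ∂(pathLaw P Z hm hc : Measure C(ℝ≥0, S)) = ∫ ω, G ⟨fun t => Z t ω, hc ω⟩ ∂P :=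
  integral_map (measurable_path Z hm hc).aemeasurable hG.measurable.aestronglyMeasurable

/-- Converts tightness on path space into compact containment of the position at a fixed time. -/
theorem measure_notMem_image_eval_le (P : Measure Ω) [IsProbabilityMeasure P] (Z : ℝ≥0 → Ω → S)
    (hm : ∀ t, Measurable (Z t)) (hc : ∀ ω, Continuous fun t => Z t ω) {K : Set C(ℝ≥0, S)}
    (hK : IsCompact K) (s : ℝ≥0) :
    P {ω | Z s ω ∉ (fun w : C(ℝ≥0, S) => w s) '' K} ≤
      (pathLaw P Z hm hc : Measure C(ℝ≥0, S)) Kᶜ := by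
  change _ ≤ P.map _ Kᶜ
  rw [Measure.map_apply (measurable_path Z hm hc) hK.measurableSet.compl]
  exact measure_mono fun ω hω hmem => hω ⟨_, hmem, rfl⟩

end PathLawIntegral

/-- A weighted integral is small if the integrand is small off a set of small probability. -/
theorem abs_integral_mul_le_of_small_off {Ω : Type*} [MeasurableSpace Ω] (P : Measure Ω)
    [IsProbabilityMeasure P] {Φ u : Ω → ℝ} {B C η : ℝ}
    (hΦ : ∀ ω, |Φ ω| ≤ B) (hη : 0 ≤ η) (hu : ∀ ω, |u ω| ≤ C) {N : Set Ω} (hN : MeasurableSet N)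
    (hsmall : ∀ ω ∉ N, |u ω| ≤ η) : |∫ ω, Φ ω * u ω ∂P| ≤ B * (η + C * P.real N) := by
  have hi : Integrable (N.indicator fun _ => C) P := (integrable_const C).indicator hN
  have hb : ‖∫ ω, Φ ω * u ω ∂P‖ ≤ ∫ ω, B * (η + N.indicator (fun _ => C) ω) ∂P := by
    refine norm_integral_le_of_norm_le (((integrable_const η).add hi).const_mul B)
      (Eventually.of_forall fun ω => ?_)
    rw [norm_mul]
    refine mul_le_mul (hΦ ω) ?_ (norm_nonneg _) ((abs_nonneg _).trans (hΦ ω))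
    by_cases h : ω ∈ N
    · rw [Set.indicator_of_mem h]
      exact (hu ω).trans (by linarith)
    · rw [Set.indicator_of_notMem h, add_zero]
      exact hsmall ω h
  rw [integral_const_mul, integral_add (integrable_const η) hi, integral_indicator_const _ hN] at hb
  simpa [mul_comm] using hb

namespace MarkovFamily

variable {M S : Type*} [MeasurableSpace M] [MetricSpace S] [TopologicalSpace.SeparableSpace S]
  [MeasurableSpace S] [BorelSpace S] {h : M → S}

open scoped BoundedContinuousFunction

/-- The conditioning is on the past of `X`, which contains that of `h (X)`; the image process need
not be Markov itself. -/
theorem integral_dynkinIncrement_pathLaw (X : MarkovFamily M) (hm : Measurable h)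
    (hc : ∀ x ω, Continuous fun t => h (X.X x t ω)) (x : M) (l : List (ℝ≥0 × (S →ᵇ ℝ)))
    (f g : C₀(S, ℝ)) (s T : ℝ≥0) (hs : ∀ p ∈ l, p.1 ≤ s) :
    ∫ w, dynkinIncrement l f g s T w ∂(pathLaw (X.P x) (fun t ω => h (X.X x t ω))
      (fun t => hm.comp (X.measurable_X x t)) (hc x) : Measure C(ℝ≥0, S)) =
    ∫ ω, cylinderProd l (fun t => h (X.X x t ω)) * X.dynkinDefect h f g T (X.X x s ω) ∂(X.P x) := by
  obtain ⟨B, hB⟩ := exists_abs_cylinderProd_le l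
  rw [integral_pathLaw _ _ _ _ (continuous_dynkinIncrement l f g s T)]
  exact X.integral_mul_dynkin hm hc f g x s T
    (measurable_cylinderProd (m := processPast (X.X x) s) (Z := fun t ω => h (X.X x t ω)) l
      fun p hp => hm.comp (X.measurable_processPast x (hs p hp))) (fun ω => hB _)

theorem integral_eval_zero_pathLaw (X : MarkovFamily M) (hm : Measurable h)
    (hc : ∀ x ω, Continuous fun t => h (X.X x t ω)) (x : M) (f : C₀(S, ℝ)) :
    ∫ w, f (w 0) ∂(pathLaw (X.P x) (fun t ω => h (X.X x t ω))
      (fun t => hm.comp (X.measurable_X x t)) (hc x) : Measure C(ℝ≥0, S)) = f (h x) := by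
  rw [integral_pathLaw _ _ _ _ (G := fun w => f (w 0))
      (f.continuous.comp (continuous_eval_const 0)),
    integral_congr_ae (g := fun _ => f (h x))]
  · simp
  · filter_upwards [X.start x] with ω hω
    simp [hω]

/-- The law of a Feller process with continuous trajectories solves the martingale problem for its
generator. -/
theorem solvesMartingaleProblem_pathLaw (Y : MarkovFamily S) (hY : Y.PreservesC0)
    (hYc : ∀ y ω, Continuous fun t => Y.X y t ω) (y : S) (F : (Y.generator hY).domain) :
    SolvesMartingaleProblem (pathLaw (Y.P y) (Y.X y) (Y.measurable_X y) (hYc y) :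
      Measure C(ℝ≥0, S)) F (Y.generator hY F) := by
  intro l s T hs
  refine (Y.integral_dynkinIncrement_pathLaw measurable_id hYc y l F _ s T hs).trans ?_
  simp [Y.dynkinDefect_generator hY hYc]

/-- If the Dynkin defects of a family of processes tend to zero uniformly over initial points in
`h ⁻¹' K`, `K` compact, then every limit point of the laws started from `x` solves the martingale
problem, provided these laws are tight. -/
theorem solvesMartingaleProblem_of_tendsto {ι : Type*} {𝓕 : Filter ι} {U : Filter ι} [U.NeBot]
    (hU : U ≤ 𝓕) (X : ι → MarkovFamily M) (hm : Measurable h)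
    (hc : ∀ ε x ω, Continuous fun t => h ((X ε).X x t ω)) (x : M) (f g : C₀(S, ℝ))
    (hdef : ∀ T : ℝ≥0, 0 < T → ∀ K : Set S, IsCompact K →
      TendstoUniformlyOn (fun ε x => (X ε).dynkinDefect h f g T x) (fun _ => 0) 𝓕 (h ⁻¹' K))
    (htight : IsTightMeasureSet (Set.range fun ε =>
      (pathLaw ((X ε).P x) (fun t ω => h ((X ε).X x t ω))
        (fun t => hm.comp ((X ε).measurable_X x t)) (hc ε x) : Measure C(ℝ≥0, S))))
    {μ : ProbabilityMeasure C(ℝ≥0, S)}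
    (hμ : Tendsto (fun ε => pathLaw ((X ε).P x) (fun t ω => h ((X ε).X x t ω))
        (fun t => hm.comp ((X ε).measurable_X x t)) (hc ε x)) U (𝓝 μ)) :
    SolvesMartingaleProblem (μ : Measure C(ℝ≥0, S)) f g := by
  intro l s T hs
  rcases eq_or_ne T 0 with rfl | hT
  · simp [dynkinIncrement]
  obtain ⟨C, hC⟩ := exists_abs_dynkinIncrement_le l f g s T
  let G : C(ℝ≥0, S) →ᵇ ℝ := BoundedContinuousFunction.ofNormedAddCommGroup
    (fun w => dynkinIncrement l f g s T w) (continuous_dynkinIncrement l f g s T) C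
    fun w => hC w
  have hlim := ProbabilityMeasure.tendsto_iff_forall_integral_tendsto.1 hμ G
  refine tendsto_nhds_unique hlim (Tendsto.mono_left ?_ hU)
  change Tendsto (fun ε => ∫ w, dynkinIncrement l f g s T w
    ∂(pathLaw ((X ε).P x) (fun t ω => h ((X ε).X x t ω))
        (fun t => hm.comp ((X ε).measurable_X x t)) (hc ε x) : Measure C(ℝ≥0, S))) 𝓕 (𝓝 0)
  simp_rw [fun ε => (X ε).integral_dynkinIncrement_pathLaw hm (hc ε) x l f g s T hs]
  obtain ⟨B, hB⟩ := exists_abs_cylinderProd_le l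
  have hB0 : 0 ≤ B := (abs_nonneg _).trans (hB fun _ => h x)
  set R : ℝ := ‖f‖ + ‖f‖ + ‖g‖ * T with hR
  have hR0 : 0 ≤ R := by positivity
  rw [Metric.tendsto_nhds]
  intro δ hδ
  -- One `η` serves twice: as the bound for the defect over the compact set, and for the probability
  -- of lying outside it, where the defect is at most `R`.
  obtain ⟨η, hη, hηδ⟩ : ∃ η > 0, B * (η + R * η) < δ := by
    refine ⟨δ / (2 * (B * (1 + R) + 1)), by positivity, ?_⟩
    have hpos : 0 < B * (1 + R) + 1 := by positivity
    calc B * (δ / (2 * (B * (1 + R) + 1)) + R * (δ / (2 * (B * (1 + R) + 1))))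
        = (B * (1 + R)) / (B * (1 + R) + 1) * (δ / 2) := by field_simp
      _ ≤ 1 * (δ / 2) := by
        gcongr
        rw [div_le_one hpos]
        linarith
      _ < δ := by linarith
  obtain ⟨𝒦, h𝒦, hmass⟩ := isTightMeasureSet_iff_exists_isCompact_measure_compl_le.1 htight
    (ENNReal.ofReal η) (by simpa using hη)
  have hK : IsCompact ((fun w : C(ℝ≥0, S) => w s) '' 𝒦) := h𝒦.image (continuous_eval_const s)
  filter_upwards [Metric.tendstoUniformlyOn_iff.1 (hdef T (pos_iff_ne_zero.2 hT) _ hK) η hη]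
    with ε hε
  rw [Real.dist_eq, sub_zero]
  have hN : MeasurableSet {ω | h ((X ε).X x s ω) ∉ (fun w : C(ℝ≥0, S) => w s) '' 𝒦} :=
    (hm.comp ((X ε).measurable_X x s)) hK.measurableSet.compl
  have hPN : ((X ε).P x).real {ω | h ((X ε).X x s ω) ∉ (fun w : C(ℝ≥0, S) => w s) '' 𝒦} ≤ η := by
    refine ENNReal.toReal_le_of_le_ofReal hη.le (le_trans ?_ (hmass _ ⟨ε, rfl⟩))
    exact measure_notMem_image_eval_le _ (fun t ω => h ((X ε).X x t ω)) _ _ h𝒦 s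
  refine lt_of_le_of_lt (abs_integral_mul_le_of_small_off ((X ε).P x) (fun ω => hB _) hη.le
    (fun ω => (X ε).abs_dynkinDefect_le f g T _) hN fun ω hω => ?_) (lt_of_le_of_lt ?_ hηδ)
  · have := hε _ (not_not.1 hω)
    rw [Real.dist_eq, zero_sub, abs_neg] at this
    exact this.le
  · gcongr

end MarkovFamily

/-! ### Convergence of the laws -/

theorem mainTheorem3
    {M S : Type*} [MetricSpace M] [MeasurableSpace M] [BorelSpace M]
    [MetricSpace S] [LocallyCompactSpace S] [TopologicalSpace.SeparableSpace S]
    [MeasurableSpace S] [BorelSpace S]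
    (h : M → S) (hh : Continuous h)
    (X : Set.Ioi (0 : ℝ) → MarkovFamily M)
    (hXc : ∀ ε x ω, Continuous fun t => h ((X ε).X x t ω))
    (Y : MarkovFamily S)
    (hYc : ∀ y ω, Continuous fun t => Y.X y t ω)
    (hY : Y.PreservesC0)
    (Ψ : Submodule ℝ C₀(S, ℝ)) (hΨ : Dense (Ψ : Set C₀(S, ℝ)))
    (D : Submodule ℝ C₀(S, ℝ)) (hD : D ≤ (Y.generator hY).domain)
    (h1 : ∃ l : ℝ, 0 < l ∧ ∀ f ∈ Ψ, ∃ F : (Y.generator hY).domain, (F : C₀(S, ℝ)) ∈ D ∧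
      l • (F : C₀(S, ℝ)) - Y.generator hY F = f)
    (h2 : ∀ T : ℝ≥0, 0 < T → ∀ f : (Y.generator hY).domain, (f : C₀(S, ℝ)) ∈ D →
      ∀ K : Set S, IsCompact K →
        TendstoUniformlyOn
          (fun (ε : Set.Ioi (0 : ℝ)) (x : M) =>
            ∫ ω, ((f : C₀(S, ℝ)) (h ((X ε).X x T ω)) - (f : C₀(S, ℝ)) (h ((X ε).X x 0 ω))
              - ∫ t in (0 : ℝ)..T, Y.generator hY f (h ((X ε).X x t.toNNReal ω))) ∂((X ε).P x))
          (fun _ => 0) (comap (fun ε : Set.Ioi (0 : ℝ) => (ε : ℝ)) (𝓝[>] 0)) (h ⁻¹' K))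
    (htight : ∀ x : M, IsTightMeasureSet (Set.range fun ε : Set.Ioi (0 : ℝ) =>
      (pathLaw ((X ε).P x) (fun t ω => h ((X ε).X x t ω))
        (fun t => hh.measurable.comp ((X ε).measurable_X x t)) (hXc ε x) :
          Measure C(ℝ≥0, S))))
    (x : M) :
    Tendsto
      (fun ε : Set.Ioi (0 : ℝ) => pathLaw ((X ε).P x) (fun t ω => h ((X ε).X x t ω))
        (fun t => hh.measurable.comp ((X ε).measurable_X x t)) (hXc ε x))
      (comap (fun ε : Set.Ioi (0 : ℝ) => (ε : ℝ)) (𝓝[>] 0))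
      (𝓝 (pathLaw (Y.P (h x)) (Y.X (h x)) (Y.measurable_X (h x)) (hYc (h x)))) := by
  have : SecondCountableTopology S := UniformSpace.secondCountable_of_separable S
  obtain ⟨c, hc, hsolve⟩ := h1
  let i : D →ₗ[ℝ] C₀(S, ℝ) := D.subtype
  let A : D →ₗ[ℝ] C₀(S, ℝ) := (Y.generator hY).toFun ∘ₗ Submodule.inclusion hD
  have hdiss : ∀ m : ℝ, 0 < m → ∀ F, m * ‖i F‖ ≤ ‖m • i F - A F‖ := fun m hm F =>
    Y.mul_norm_le_norm_smul_sub_generator hY hm (Submodule.inclusion hD F)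
  have hd : DenseRange fun F => c • i F - A F := by
    refine hΨ.mono fun f hf => ?_
    obtain ⟨F, hFD, hF⟩ := hsolve f hf
    exact ⟨⟨F, hFD⟩, hF⟩
  -- Ultrafilters play the role of subsequences: by Prokhorov the laws converge along `U` to some
  -- `μ`, and it remains to identify `μ`.
  refine (tendsto_iff_ultrafilter _ _ _).2 fun U hU => ?_
  have hcompact := isCompact_closure_of_isTightMeasureSet (S := Set.range fun ε =>
    pathLaw ((X ε).P x) (fun t ω => h ((X ε).X x t ω))
      (fun t => hh.measurable.comp ((X ε).measurable_X x t)) (hXc ε x))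
    ((htight x).subset (by rintro _ ⟨_, ⟨ε, rfl⟩, rfl⟩; exact ⟨ε, rfl⟩))
  obtain ⟨μ, -, hμ⟩ := hcompact.ultrafilter_le_nhds (U.map _)
    (le_principal_iff.2 (mem_map.2 (Eventually.of_forall fun ε => subset_closure ⟨ε, rfl⟩)))
  have hμ' : Tendsto (fun ε => pathLaw ((X ε).P x) (fun t ω => h ((X ε).X x t ω))
      (fun t => hh.measurable.comp ((X ε).measurable_X x t)) (hXc ε x)) U (𝓝 μ) := hμ
  suffices heq : (μ : Measure C(ℝ≥0, S)) =
      pathLaw (Y.P (h x)) (Y.X (h x)) (Y.measurable_X (h x)) (hYc (h x)) by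
    rwa [Subtype.ext heq] at hμ'
  have hsolμ : ∀ F, SolvesMartingaleProblem (μ : Measure C(ℝ≥0, S)) (i F) (A F) := fun F =>
    MarkovFamily.solvesMartingaleProblem_of_tendsto hU X hh.measurable hXc x _ _
      (fun T hT K hK => h2 T hT (Submodule.inclusion hD F) F.2 K hK) (htight x) hμ'
  have hsolY : ∀ F, SolvesMartingaleProblem (pathLaw (Y.P (h x)) (Y.X (h x))
      (Y.measurable_X (h x)) (hYc (h x)) : Measure C(ℝ≥0, S)) (i F) (A F) := fun F =>
    Y.solvesMartingaleProblem_pathLaw hY hYc (h x) (Submodule.inclusion hD F)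
  have hinit : ∀ f : C₀(S, ℝ), ∫ w, f (w 0) ∂(μ : Measure C(ℝ≥0, S)) = f (h x) := fun f => by
    have hlim := ProbabilityMeasure.tendsto_iff_forall_integral_tendsto.1 hμ'
      (f.toBCF.compContinuous ⟨fun w : C(ℝ≥0, S) => w 0, continuous_eval_const 0⟩)
    refine tendsto_nhds_unique hlim (tendsto_const_nhds.congr fun ε => ?_)
    exact ((X ε).integral_eval_zero_pathLaw hh.measurable (hXc ε) x f).symm
  have hinitY : ∀ f : C₀(S, ℝ), ∫ w, f (w 0) ∂(pathLaw (Y.P (h x)) (Y.X (h x))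
      (Y.measurable_X (h x)) (hYc (h x)) : Measure C(ℝ≥0, S)) = f (h x) := fun f =>
    Y.integral_eval_zero_pathLaw measurable_id hYc (h x) f
  refine ext_of_integral_cylinderProd fun l => ?_
  exact integral_cylinderProd_eq i A hdiss hc hd hsolμ hsolY
    (fun f => (hinit f).trans (hinitY f).symm) l
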